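/- **Setting.** An *ontology* $\mathcal T$ is a finite set of tuple-generating dependencies $\forall \vec x\,(\varphi(\vec x)\to\exists\vec y\,\bigwedge_i\psi_i(\vec x,\vec y))$, where $\varphi$ and the $\psi_i$ are unary or binary atoms without constants, all variables of $\vec x$ occur in $\varphi$, and $|\vec x\cup\vec y|\le 2$; its size $|\mathcal T|$ is the number of predicate occurrences in it. A *conjunctive query* (CQ) $q(\vec x)=\exists\vec y\,\varphi(\vec x,\vec y)$ is an existentially quantified conjunction of unary and binary atoms without constants, each of whose answer variables $\vec x$ occurs in some atom; $|q|$ is the number of occurrences of predicates and variables in it. A *data instance* $\mathcal A$ is a finite set of unary and binary ground atoms, $\mathrm{ind}(\mathcal A)$ is the set of constants in it, and $\mathcal A$ is *complete* for $\mathcal T$ if it contains every ground atom over $\mathrm{ind}(\mathcal A)$ that is entailed by $(\mathcal T,\mathcal A)$. We write $\mathcal T,\mathcal A\models q(\vec a)$ if $q(\vec a)$ holds in all models of $\mathcal T$ and $\mathcal A$. For $\varrho(x)$ of the form $A(x)$, $P(x,x)$, $\exists y\,P(x,y)$ or $\exists y\,P(y,x)$ with a predicate occurring in $\mathcal T$,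 a *canonical model* of $\mathcal T$ and $\varrho(a)$ is a model of $\mathcal T$ and $\varrho(a)$ that maps homomorphically, with $a$ preserved, into every model of $\mathcal T$ and $\varrho(a)$ (for example, the chase); its elements other than $a$ are called *labelled nulls*. The ontology $\mathcal T$ is *of depth at most $1$* if, for every such $\varrho$, there is a canonical model of $\mathcal T$ and $\varrho(a)$ which, loops at $a$ disregarded, is a forest of depth at most $1$ having $a$ as one of its roots (every binary atom connects a root with one of its children, in either direction; in particular, there are no loops at labelled nulls). A *nonrecursive datalog (NDL) program* $\Pi$ is a finite set of Horn clauses $\gamma_0\leftarrow\gamma_1\land\dots\land\gamma_m$ without constants and equality, in which every variable of the head occurs in the body, the heads use intensional predicates only (which do not occur in data, and may have any arity), and the dependence relation between predicates is acyclic; its size $|\Pi|$ is the number of occurrences of predicates and variables in it. The pair of $\Pi$ and an atom $G(\vec x)$ is an *NDL-rewriting* of $q(\vec x)$ and $\mathcal T$ if, for every data instance $\mathcal A$ complete for $\mathcal T$ and every tuple $\vec a$ in $\mathrm{ind}(\mathcal A)$, we have $\mathcal T,\mathcal A\models q(\vec a)$ if and only if $\Pi,\mathcal A\models G(\vec a)$.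 **Theorem.** There is a polynomial $p$ such that every CQ $q$ and every ontology $\mathcal T$ of depth at most $1$ have an NDL-rewriting $(\Pi,G(\vec x))$ with $|\Pi|\le p(|\mathcal T|+|q|)$. -/

import Mathlib

/-! Ontologies given by two-variable linear tgds, conjunctive queries, data instances,
certain answers, depth, and nonrecursive datalog rewritings. Names of unary predicates, of binary
predicates, of intensional datalog predicates, of variables and of individual constants are
natural numbers; the four kinds of symbols are kept apart by the constructors below. -/

namespace OBDA

/-- Unary atoms `A(t)` and binary atoms `P(s, t)` over terms from `τ`. -/
inductive Atom (τ : Type) : Type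
  | un (A : ℕ) (t : τ) : Atom τ
  | bin (P : ℕ) (s t : τ) : Atom τ

/-- The list of arguments of an atom. -/
def Atom.args {τ : Type} : Atom τ → List τ
  | .un _ t => [t]
  | .bin _ s t => [s, t]

/-- Substitution of terms in an atom. -/
def Atom.map {τ τ' : Type} (f : τ → τ') : Atom τ → Atom τ'
  | .un A t => .un A (f t)
  | .bin P s t => .bin P (f s) (f t)

/-- A relational structure with domain `D` for the unary and binary predicates. -/
structure Interp (D : Type) where
  un : ℕ → D → Prop
  bin : ℕ → D → D → Prop

/-- `I.Sat v α`: the atom `α` is true in `I` under the assignment `v` of its terms. -/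
def Interp.Sat {D τ : Type} (I : Interp D) (v : τ → D) : Atom τ → Prop
  | .un A t => I.un A (v t)
  | .bin P s t => I.bin P (v s) (v t)

/-- Homomorphisms of relational structures. -/
def Interp.IsHom {D E : Type} (I : Interp D) (J : Interp E) (h : D → E) : Prop :=
  (∀ A u, I.un A u → J.un A (h u)) ∧ (∀ P u v, I.bin P u v → J.bin P (h u) (h v))

/-- A tgd `∀ x (φ(x) → ∃ y ⋀ ψᵢ(x, y))` in which `x` and `y` have at most two variables together,
namely `0` and `1`. The universally quantified variables are those of the body `φ`; the variables
of the head that do not occur in the body are existentially quantified. -/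
structure Tgd where
  body : Atom (Fin 2)
  head : List (Atom (Fin 2))

/-- Truth of a tgd in a structure. -/
def Interp.SatTgd {D : Type} (I : Interp D) (t : Tgd) : Prop :=
  ∀ v : Fin 2 → D, I.Sat v t.body →
    ∃ v' : Fin 2 → D, (∀ x ∈ t.body.args, v' x = v x) ∧ ∀ ψ ∈ t.head, I.Sat v' ψ

/-- An ontology is a finite collection of tgds. -/
structure Ontology where
  tgds : List Tgd

/-- The size of an ontology: its number of predicate occurrences. -/
def Ontology.size (T : Ontology) : ℕ :=
  (T.tgds.map fun t => 1 + t.head.length).sum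

/-- `I` is a model of the ontology `T`. -/
def Interp.SatOntology {D : Type} (I : Interp D) (T : Ontology) : Prop :=
  ∀ t ∈ T.tgds, I.SatTgd t

/-- A data instance is a finite set of ground atoms. -/
abbrev Data := Finset (Atom ℕ)

/-- The individual constants that occur in a data instance. -/
def ind (𝒜 : Data) : Set ℕ := {c | ∃ α ∈ 𝒜, c ∈ α.args}

/-- The structure `I`, with the constants interpreted by `ι`, is a model of the knowledge base
`(T, 𝒜)`. -/
def IsModel {D : Type} (T : Ontology) (𝒜 : Data) (I : Interp D) (ι : ℕ → D) : Prop :=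
  I.SatOntology T ∧ ∀ α ∈ 𝒜, I.Sat ι α

/-- `𝒜` is complete for `T`: it contains all ground atoms over `ind 𝒜` entailed by `(T, 𝒜)`. -/
def IsComplete (T : Ontology) (𝒜 : Data) : Prop :=
  ∀ α : Atom ℕ, (∀ c ∈ α.args, c ∈ ind 𝒜) →
    (∀ (D : Type) (I : Interp D) (ι : ℕ → D), IsModel T 𝒜 I ι → I.Sat ι α) → α ∈ 𝒜

/-- A conjunctive query with the tuple `ans` of answer variables; all other variables of `atoms`
are existentially quantified. Every answer variable occurs in some atom. -/
structure CQ where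
  arity : ℕ
  ans : Fin arity → ℕ
  atoms : List (Atom ℕ)
  ans_mem : ∀ i, ∃ α ∈ atoms, ans i ∈ α.args

/-- The size of a query: its number of occurrences of predicates and variables. -/
def CQ.size (q : CQ) : ℕ := q.arity + (q.atoms.map fun α => 1 + α.args.length).sum

/-- `I ⊨ q(d)`. -/
def CQ.Holds {D : Type} (q : CQ) (I : Interp D) (d : Fin q.arity → D) : Prop :=
  ∃ v : ℕ → D, (∀ i, v (q.ans i) = d i) ∧ ∀ α ∈ q.atoms, I.Sat v α

/-- `T, 𝒜 ⊨ q(c)`: the tuple `c` satisfies `q` in all models of `(T, 𝒜)`. -/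
def CertainAnswer (T : Ontology) (𝒜 : Data) (q : CQ) (c : Fin q.arity → ℕ) : Prop :=
  ∀ (D : Type) (I : Interp D) (ι : ℕ → D), IsModel T 𝒜 I ι → q.Holds I fun i => ι (c i)

/-- The formulas `ϱ(x)` of the form `A(x)`, `P(x, x)`, `∃ y P(x, y)` and `∃ y P(y, x)`. -/
inductive Gen : Type
  | un (A : ℕ) : Gen
  | loop (P : ℕ) : Gen
  | out (P : ℕ) : Gen
  | inc (P : ℕ) : Gen

/-- `I ⊨ ϱ(a)`. -/
def Gen.Holds {D : Type} (I : Interp D) (a : D) : Gen → Prop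
  | .un A => I.un A a
  | .loop P => I.bin P a a
  | .out P => ∃ w, I.bin P a w
  | .inc P => ∃ w, I.bin P w a

/-- The atom `α` occurs in `T`. -/
def Ontology.Occurs (T : Ontology) (α : Atom (Fin 2)) : Prop :=
  ∃ t ∈ T.tgds, α = t.body ∨ α ∈ t.head

/-- The predicate of `ϱ` occurs in `T`. -/
def Gen.InSignature (T : Ontology) : Gen → Prop
  | .un A => ∃ x, T.Occurs (.un A x)
  | .loop P | .out P | .inc P => ∃ x y, T.Occurs (.bin P x y)

/-- `I` is a canonical (universal) model of `T` and `ϱ(a)`, as is the chase: it is a model and it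
maps homomorphically, with `a` going to `b`, into every model of `T` and `ϱ(b)`. -/
def IsCanonical {D : Type} (T : Ontology) (ϱ : Gen) (I : Interp D) (a : D) : Prop :=
  I.SatOntology T ∧ ϱ.Holds I a ∧
    ∀ (E : Type) (J : Interp E) (b : E), J.SatOntology T → ϱ.Holds J b →
      ∃ h : D → E, I.IsHom J h ∧ h a = b

/-- The structure `I`, loops at the individual `a` disregarded, is a forest of depth at most `k`,
one of whose roots is `a`: any other binary atom connects a node with its parent. The elements
different from `a` are the labelled nulls; a null may be a root if it is not linked to the element
for which it was introduced. In particular, there are no loops at nulls. -/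
def IsForest {D : Type} (I : Interp D) (a : D) (k : ℕ) : Prop :=
  ∃ (parent : D → Option D) (level : D → ℕ),
    parent a = none ∧ (∀ u, level u ≤ k) ∧
    (∀ u v, parent u = some v → level v < level u) ∧
    ∀ P u v, I.bin P u v → (u = a ∧ v = a) ∨ parent u = some v ∨ parent v = some u

/-- `T` is of depth at most `k`: for every `ϱ` in the signature of `T`, the KB consisting of `T`
and `ϱ(a)` has a canonical model that is a forest of depth at most `k`. -/
def Ontology.DepthLE (T : Ontology) (k : ℕ) : Prop :=
  ∀ ϱ : Gen, ϱ.InSignature T →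
    ∃ (D : Type) (I : Interp D) (a : D), IsCanonical T ϱ I a ∧ IsForest I a k

/-- The atoms of a datalog clause: extensional atoms, whose predicates are those of the ontology,
query and data, and intensional atoms `G(t₁, …, tₗ)`, `l ≥ 0`. -/
inductive DAtom : Type
  | edb (α : Atom ℕ) : DAtom
  | idb (G : ℕ) (args : List ℕ) : DAtom

/-- The list of arguments (variables) of an atom of a clause. -/
def DAtom.args : DAtom → List ℕ
  | .edb α => α.args
  | .idb _ xs => xs

/-- A Horn clause `head(headArgs) ← body` in which all variables of the head occur in the body.
The predicate of the head is intensional. -/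
structure Clause where
  head : ℕ
  headArgs : List ℕ
  body : List DAtom
  safe : ∀ x ∈ headArgs, ∃ β ∈ body, x ∈ β.args

/-- A datalog program: finitely many clauses, each intensional predicate being used with its
arity. -/
structure Program where
  clauses : List Clause
  arity : ℕ → ℕ
  head_arity : ∀ r ∈ clauses, r.headArgs.length = arity r.head
  body_arity : ∀ r ∈ clauses, ∀ G xs, DAtom.idb G xs ∈ r.body → xs.length = arity G

/-- The size of a program: its number of occurrences of predicates and variables. -/
def Program.size (Pr : Program) : ℕ :=
  (Pr.clauses.map fun r =>
    (1 + r.headArgs.length) + (r.body.map fun β => 1 + β.args.length).sum).sum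

/-- `G` depends on `G'` in `Pr`. (Extensional predicates never occur in heads, and so they are
irrelevant to cycles.) -/
def Program.Depends (Pr : Program) (G G' : ℕ) : Prop :=
  ∃ r ∈ Pr.clauses, r.head = G ∧ ∃ xs, DAtom.idb G' xs ∈ r.body

/-- The dependence relation of `Pr` is acyclic. -/
def Program.Nonrecursive (Pr : Program) : Prop :=
  ∀ G, ¬ Relation.TransGen Pr.Depends G G

/-- `Pr.Entails 𝒜 G c`: the ground atom `G(c)` is derivable from `Pr` and `𝒜`, that is,
`Pr, 𝒜 ⊨ G(c)`. -/
inductive Program.Entails (Pr : Program) (𝒜 : Data) : ℕ → List ℕ → Prop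
  | step (r : Clause) (hr : r ∈ Pr.clauses) (σ : ℕ → ℕ)
      (hedb : ∀ α, DAtom.edb α ∈ r.body → α.map σ ∈ 𝒜)
      (hidb : ∀ G xs, DAtom.idb G xs ∈ r.body → Program.Entails Pr 𝒜 G (xs.map σ)) :
      Program.Entails Pr 𝒜 r.head (r.headArgs.map σ)

/-- `(Pr, G(x))` is an NDL-rewriting of `q(x)` and `T` (over complete data). -/
def IsNDLRewriting (T : Ontology) (q : CQ) (Pr : Program) (G : ℕ) : Prop :=
  Pr.Nonrecursive ∧ Pr.arity G = q.arity ∧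
    ∀ 𝒜 : Data, IsComplete T 𝒜 → ∀ c : Fin q.arity → ℕ, (∀ i, c i ∈ ind 𝒜) →
      (CertainAnswer T 𝒜 q c ↔ Pr.Entails 𝒜 G (List.ofFn c))

end OBDA

namespace OBDA

/-! ### Atoms, satisfaction and homomorphisms -/

/-! With at most two variables per tgd, a head with an existential variable forces a body with a
single variable, `A(x)` or `P(x, x)`. Over complete data one therefore obtains a model by gluing to
each individual `c` a canonical model of every `g(c)` in the data (`glue_isModel`). Certain answers
hold in it, and conversely its pieces map into every model.

Depth 1 makes matches in the glued model simple. A variable sent to a child of an individual has all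
its neighbours at that individual. A variable sent to any other null drags its whole connected
component into the nulls of the same copy, so that the component has no answer variables. Let `σ`
send each variable to the individual to which its image belongs. Given `σ`, it remains to choose the
variables that become children: each must pass a local test, distinct co-occurring variables are not
both chosen, and each atom contains a chosen variable or is accounted for directly. As atoms have at
most two arguments, this is a 2-CNF (`certainAnswer_of_satisfiable`,
`exists_satisfiable_of_certainAnswer`).

A 2-CNF is decided by eliminating its variables one by one, resolution producing only clauses of at
most two literals (`satisfiable_iff_eliminate`). That a clause is *not* imposed is a monotone
condition on the data, and resolution preserves this. The result is a monotone circuit of polynomial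
size, written as an NDL program in which every gate carries the values of all query variables; the
goal clause quantifies `σ` (`entails_goal`). The tests `LocalMatch` and `CompMatch` do not involve
the data and are settled when the program is written down. -/

theorem Atom.args_map {τ τ' : Type} (f : τ → τ') (α : Atom τ) :
    (α.map f).args = α.args.map f := by
  cases α <;> rfl

theorem Atom.map_congr {τ τ' : Type} {f g : τ → τ'} {α : Atom τ}
    (h : ∀ x ∈ α.args, f x = g x) : α.map f = α.map g := by
  cases α <;> simp_all [Atom.args, Atom.map]

theorem Interp.sat_map {D τ τ' : Type} (I : Interp D) (f : τ → τ') (v : τ' → D) (α : Atom τ) :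
    I.Sat v (α.map f) ↔ I.Sat (fun x => v (f x)) α := by
  cases α <;> rfl

theorem Interp.sat_congr {D τ : Type} {I : Interp D} {v w : τ → D} {α : Atom τ}
    (h : ∀ x ∈ α.args, v x = w x) : I.Sat v α ↔ I.Sat w α := by
  cases α <;> simp_all [Atom.args, Interp.Sat]

theorem Interp.IsHom.sat {D E τ : Type} {I : Interp D} {J : Interp E} {h : D → E}
    (hh : I.IsHom J h) {v : τ → D} {α : Atom τ} (hs : I.Sat v α) :
    J.Sat (fun x => h (v x)) α := by
  cases α
  · exact hh.1 _ _ hs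
  · exact hh.2 _ _ _ hs

/-- Some argument of an atom. -/
def Atom.fst {τ : Type} : Atom τ → τ
  | .un _ t => t
  | .bin _ s _ => s

theorem Atom.fst_mem {τ : Type} (α : Atom τ) : α.fst ∈ α.args := by
  cases α <;> simp [Atom.fst, Atom.args]

/-- The atoms `A(·)` and `P(·, ·)` for all predicate occurrences in the ontology. -/
def Ontology.gens (T : Ontology) : List (Atom Unit) :=
  T.tgds.flatMap fun t => (t.body :: t.head).map (Atom.map fun _ => ())

theorem Ontology.length_gens (T : Ontology) : T.gens.length = T.size := by
  simp [Ontology.gens, Ontology.size, List.length_flatMap, add_comm]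

/-- The ground atom `g(c)`. -/
def Atom.at {τ : Type} (g : Atom Unit) (c : τ) : Atom τ := g.map fun _ => c

theorem Interp.sat_at {D τ : Type} (I : Interp D) (g : Atom Unit) (v : τ → D) (c : τ) :
    I.Sat v (g.at c) ↔ I.Sat (fun _ => v c) g :=
  I.sat_map _ v g

theorem Atom.mem_args_at {τ : Type} (g : Atom Unit) (c x : τ) : x ∈ (g.at c).args ↔ x = c := by
  cases g <;> simp [Atom.at, Atom.map, Atom.args]

/-- A structure with a distinguished element. -/
structure Pointed where
  D : Type
  I : Interp D
  a : D

/-- `M` is a canonical model of `T` and `g(a)` in the shape of a forest of depth at most 1. -/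
structure Pointed.IsGen (M : Pointed) (T : Ontology) (g : Atom Unit) : Prop where
  model : M.I.SatOntology T
  holds : M.I.Sat (fun _ => M.a) g
  univ : ∀ (E : Type) (J : Interp E) (b : E), J.SatOntology T → J.Sat (fun _ => b) g →
    ∃ h : M.D → E, M.I.IsHom J h ∧ h M.a = b
  forest : IsForest M.I M.a 1

/-- Only the forms `A(x)` and `P(x, x)` are needed: a body with two distinct variables leaves no
room for an existential one, and its head is then covered by completeness of the data. -/
theorem Ontology.DepthLE.exists_gen {T : Ontology} (hT : T.DepthLE 1) :
    ∃ C : Atom Unit → Pointed, ∀ g ∈ T.gens, (C g).IsGen T g := by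
  have key : ∀ g : Atom Unit, ∃ M : Pointed, g ∈ T.gens → M.IsGen T g := by
    intro g
    by_cases hg : g ∈ T.gens
    · simp only [Ontology.gens, List.mem_flatMap, List.mem_map] at hg
      obtain ⟨t, ht, β, hβ, rfl⟩ := hg
      have hocc : T.Occurs β := ⟨t, ht, by simpa using hβ⟩
      cases β with
      | un A x =>
        obtain ⟨D, I, a, ⟨h1, h2, h3⟩, h4⟩ := hT (.un A) ⟨x, hocc⟩
        exact ⟨⟨D, I, a⟩, fun _ => ⟨h1, h2, h3, h4⟩⟩
      | bin P x y =>
        obtain ⟨D, I, a, ⟨h1, h2, h3⟩, h4⟩ := hT (.loop P) ⟨x, y, hocc⟩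
        exact ⟨⟨D, I, a⟩, fun _ => ⟨h1, h2, h3, h4⟩⟩
    · exact ⟨⟨Unit, ⟨fun _ _ => True, fun _ _ _ => True⟩, ()⟩, fun h => absurd h hg⟩
  choose C hC using key
  exact ⟨C, hC⟩

/-! ### The canonical model of complete data -/

/-- The domain of the canonical model: individuals and labelled nulls. -/
abbrev GlueDom (C : Atom Unit → Pointed) : Type := ℕ ⊕ (ℕ × Σ g : Atom Unit, (C g).D)

open Classical in
/-- The embedding of the canonical model of `g(c)`. -/
noncomputable def emb (C : Atom Unit → Pointed) (c : ℕ) (g : Atom Unit) (d : (C g).D) :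
    GlueDom C :=
  if d = (C g).a then .inl c else .inr (c, ⟨g, d⟩)

theorem emb_root (C : Atom Unit → Pointed) (c : ℕ) (g : Atom Unit) :
    emb C c g (C g).a = .inl c := by simp [emb]

theorem emb_eq_inl {C : Atom Unit → Pointed} {c c' : ℕ} {g : Atom Unit} {d : (C g).D}
    (h : emb C c g d = .inl c') : c = c' ∧ d = (C g).a := by
  unfold emb at h
  split_ifs at h with hd
  exact ⟨by simpa using h, hd⟩

theorem emb_eq_inr {C : Atom Unit → Pointed} {c c' : ℕ} {g g' : Atom Unit} {d : (C g).D}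
    {d' : (C g').D} (h : emb C c g d = .inr (c', ⟨g', d'⟩)) :
    d ≠ (C g).a ∧ c = c' ∧ g = g' ∧ HEq d d' := by
  unfold emb at h
  split_ifs at h with hd
  simp only [Sum.inr.injEq, Prod.mk.injEq, Sigma.mk.injEq] at h
  exact ⟨hd, h⟩

/-- The individual to which an element of the canonical model belongs. -/
def root {C : Atom Unit → Pointed} : GlueDom C → ℕ
  | .inl c => c
  | .inr (c, _) => c

theorem root_emb {C : Atom Unit → Pointed} (c : ℕ) (g : Atom Unit) (d : (C g).D) :
    root (emb C c g d) = c := by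
  unfold emb
  split_ifs <;> rfl

/-- The data, with the canonical models of all true `g(c)` glued to it. -/
noncomputable def glue (𝒜 : Data) (gens : List (Atom Unit)) (C : Atom Unit → Pointed) :
    Interp (GlueDom C) where
  un A u := (∃ c, u = .inl c ∧ Atom.un A c ∈ 𝒜) ∨
    ∃ c, ∃ g ∈ gens, g.at c ∈ 𝒜 ∧ ∃ d, u = emb C c g d ∧ (C g).I.un A d
  bin P u u' := (∃ c c', u = .inl c ∧ u' = .inl c' ∧ Atom.bin P c c' ∈ 𝒜) ∨
    ∃ c, ∃ g ∈ gens, g.at c ∈ 𝒜 ∧ ∃ d d', u = emb C c g d ∧ u' = emb C c g d' ∧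
      (C g).I.bin P d d'

section Glue

variable {𝒜 : Data} {T : Ontology} {C : Atom Unit → Pointed}

theorem glue_isHom {c : ℕ} {g : Atom Unit} (hg : g ∈ T.gens) (hc : g.at c ∈ 𝒜) :
    (C g).I.IsHom (glue 𝒜 T.gens C) (emb C c g) :=
  ⟨fun _ d h => .inr ⟨c, g, hg, hc, d, rfl, h⟩,
    fun _ d d' h => .inr ⟨c, g, hg, hc, d, d', rfl, rfl, h⟩⟩

theorem glue_sat_cases {τ : Type} {v : τ → GlueDom C} {α : Atom τ}
    (h : (glue 𝒜 T.gens C).Sat v α) :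
    ((∀ x ∈ α.args, v x = .inl (root (v x))) ∧ α.map (fun x => root (v x)) ∈ 𝒜) ∨
    ∃ c, ∃ g ∈ T.gens, g.at c ∈ 𝒜 ∧ ∃ δ : τ → (C g).D,
      (∀ x ∈ α.args, v x = emb C c g (δ x)) ∧ (C g).I.Sat δ α := by
  classical
  cases α with
  | un A t =>
    rcases h with ⟨c, h1, h2⟩ | ⟨c, g, hg, hc, d, h1, h2⟩
    · left
      simp_all [Atom.args, Atom.map, root]
    · right
      exact ⟨c, g, hg, hc, fun _ => d, by simpa [Atom.args] using h1, h2⟩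
  | bin P s t =>
    rcases h with ⟨c, c', h1, h1', h2⟩ | ⟨c, g, hg, hc, d, d', h1, h1', h2⟩
    · left
      simp_all [Atom.args, Atom.map, root]
    · right
      -- A term occurring twice in the atom needs a single preimage, hence injectivity of `emb`.
      have inj : ∀ e e' : (C g).D, emb C c g e = emb C c g e' → e = e' := by
        intro e e' he
        by_cases h' : e' = (C g).a
        · subst h'
          rw [emb_root] at he
          exact (emb_eq_inl he).2
        · rw [show emb C c g e' = .inr (c, ⟨g, e'⟩) by simp [emb, h']] at he
          exact eq_of_heq (emb_eq_inr he).2.2.2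
      by_cases hst : s = t
      · subst hst
        obtain rfl := inj _ _ (h1.symm.trans h1')
        exact ⟨c, g, hg, hc, fun _ => d, by simpa [Atom.args] using h1, h2⟩
      · refine ⟨c, g, hg, hc, fun x => if x = s then d else d', ?_, ?_⟩
        · simp [Atom.args, h1, h1', Ne.symm hst]
        · simpa [Interp.Sat, Ne.symm hst] using h2

/-- Atoms over individuals that hold in the canonical model of `g(c)` are in complete data. -/
theorem mem_of_gen (hA : IsComplete T 𝒜) (hC : ∀ g ∈ T.gens, (C g).IsGen T g) {c : ℕ}
    {g : Atom Unit} (hg : g ∈ T.gens) (hc : g.at c ∈ 𝒜) {α : Atom ℕ}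
    (hα : (C g).I.Sat (fun _ => (C g).a) α) (hv : ∀ x ∈ α.args, x = c) : α ∈ 𝒜 := by
  refine hA α (fun x hx => ⟨_, hc, by rw [Atom.mem_args_at]; exact hv x hx⟩) ?_
  intro E J ι hJ
  obtain ⟨h, hh, ha⟩ := (hC g hg).univ E J (ι c) hJ.1 ((J.sat_at g ι c).1 (hJ.2 _ hc))
  refine (Interp.sat_congr fun x hx => ?_).1 (hh.sat hα)
  rw [ha, hv x hx]

theorem satTgd_of_hom {D E : Type} {I : Interp D} {J : Interp E} {h : D → E} (hh : I.IsHom J h)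
    {t : Tgd} (ht : I.SatTgd t) {v : Fin 2 → E} {δ : Fin 2 → D}
    (hv : ∀ x ∈ t.body.args, v x = h (δ x)) (hδ : I.Sat δ t.body) :
    ∃ v' : Fin 2 → E, (∀ x ∈ t.body.args, v' x = v x) ∧ ∀ ψ ∈ t.head, J.Sat v' ψ := by
  obtain ⟨δ', h1, h2⟩ := ht δ hδ
  exact ⟨fun x => h (δ' x), fun x hx => by rw [hv x hx, ← h1 x hx], fun ψ hψ => hh.sat (h2 ψ hψ)⟩

/-- A body true inside a copy is handled by the copy, which is a model. A body from the data either
sits at one individual, where it is itself a generator, or mentions both variables, and then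
completeness supplies the head. -/
theorem glue_satOntology (hA : IsComplete T 𝒜) (hC : ∀ g ∈ T.gens, (C g).IsGen T g) :
    (glue 𝒜 T.gens C).SatOntology T := by
  intro t ht v hv
  rcases glue_sat_cases hv with ⟨h1, h2⟩ | ⟨c, g, hg, hc, δ, h1, h2⟩
  · have hbody : t.body.map (fun _ => ()) ∈ T.gens :=
      List.mem_flatMap.2 ⟨t, ht, List.mem_map.2 ⟨_, by simp, rfl⟩⟩
    by_cases hone : ∃ c, ∀ x ∈ t.body.args, v x = .inl c
    · obtain ⟨c, hone⟩ := hone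
      have hc : (t.body.map fun _ => ()).at c ∈ 𝒜 := by
        convert h2 using 1
        have : t.body.map (fun x => root (v x)) = t.body.map (fun _ => c) :=
          Atom.map_congr fun x hx => by rw [hone x hx]; rfl
        rw [this]
        cases t.body <;> rfl
      refine satTgd_of_hom (glue_isHom hbody hc) ((hC _ hbody).model t ht)
        (δ := fun _ => (C _).a) ?_ ?_
      · intro x hx
        rw [hone x hx, emb_root]
      · exact (Interp.sat_map _ _ _ _).1 (hC _ hbody).holds
    · have hall : ∀ x : Fin 2, x ∈ t.body.args := by
        rcases hb : t.body with ⟨A, s⟩ | ⟨P, s, r⟩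
        · refine absurd ⟨root (v s), fun x hx => ?_⟩ hone
          have := h1 x hx
          rw [hb] at hx
          simp only [Atom.args, List.mem_singleton] at hx
          rw [hx] at this ⊢
          exact this
        · have hsr : s ≠ r := by
            rintro rfl
            refine absurd ⟨root (v s), fun x hx => ?_⟩ hone
            have := h1 x hx
            rw [hb] at hx
            simp only [Atom.args, List.mem_cons, List.not_mem_nil, or_false, or_self] at hx
            rw [hx] at this ⊢
            exact this
          intro x
          simp only [Atom.args, List.mem_cons, List.not_mem_nil, or_false]
          omega
      refine ⟨v, fun _ _ => rfl, fun ψ hψ => ?_⟩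
      have hmem : ψ.map (fun x => root (v x)) ∈ 𝒜 := by
        refine hA _ ?_ ?_
        · intro c hc
          rw [Atom.args_map, List.mem_map] at hc
          obtain ⟨x, -, rfl⟩ := hc
          exact ⟨_, h2, by rw [Atom.args_map]; exact List.mem_map_of_mem (hall x)⟩
        · intro E J ι hJ
          obtain ⟨v', h3, h4⟩ := hJ.1 t ht (fun x => ι (root (v x)))
            ((J.sat_map _ ι _).1 (hJ.2 _ h2))
          rw [J.sat_map]
          exact (Interp.sat_congr fun x _ => h3 x (hall x)).1 (h4 ψ hψ)
      cases ψ with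
      | un A s => exact .inl ⟨_, h1 s (hall s), hmem⟩
      | bin P s r => exact .inl ⟨_, _, h1 s (hall s), h1 r (hall r), hmem⟩
  · exact satTgd_of_hom (glue_isHom hg hc) ((hC g hg).model t ht) h1 h2

theorem glue_isModel (hA : IsComplete T 𝒜) (hC : ∀ g ∈ T.gens, (C g).IsGen T g) :
    IsModel T 𝒜 (glue 𝒜 T.gens C) .inl := by
  refine ⟨glue_satOntology hA hC, fun α hα => ?_⟩
  cases α with
  | un A s => exact .inl ⟨_, rfl, hα⟩
  | bin P s r => exact .inl ⟨_, _, rfl, rfl, hα⟩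

end Glue

/-! ### Satisfiability of 2-CNFs by elimination of variables -/

/-- A literal is a signed variable or, if it is `none`, the constant false. -/
abbrev Lit : Type := Option (ℕ × Bool)

/-- Truth of a literal. -/
def Lit.True (χ : ℕ → Bool) : Lit → Prop
  | none => False
  | some (z, b) => χ z = b

/-- The literals over a list of variables. -/
def lits (V : List ℕ) : List Lit :=
  none :: V.flatMap fun z => [some (z, true), some (z, false)]

theorem none_mem_lits (V : List ℕ) : none ∈ lits V := by simp [lits]

theorem some_mem_lits {V : List ℕ} {z : ℕ} {b : Bool} : some (z, b) ∈ lits V ↔ z ∈ V := by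
  cases b <;> simp [lits]

theorem length_lits (V : List ℕ) : (lits V).length = 2 * V.length + 1 := by
  simp [lits, List.length_flatMap, mul_comm]

/-- Given `ok l l'`, saying that the clause `l ∨ l'` is not imposed, resolution on `z`. -/
def resolve (z : ℕ) (ok : Lit → Lit → Prop) (l l' : Lit) : Prop :=
  ok l l' ∧
  (ok l (some (z, true)) ∧ ok (some (z, true)) (some (z, true)) ∨
    ok l' (some (z, false)) ∧ ok (some (z, false)) (some (z, false))) ∧
  (ok l (some (z, false)) ∧ ok (some (z, false)) (some (z, false)) ∨
    ok l' (some (z, true)) ∧ ok (some (z, true)) (some (z, true)))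

/-- Satisfiability of the clauses over `V` that are imposed. -/
def Satisfiable (ok : Lit → Lit → Prop) (V : List ℕ) : Prop :=
  ∃ χ : ℕ → Bool, ∀ l ∈ lits V, ∀ l' ∈ lits V, ok l l' ∨ Lit.True χ l ∨ Lit.True χ l'

theorem resolve_symm {z : ℕ} {ok : Lit → Lit → Prop} (h : ∀ l l', ok l l' → ok l' l) (l l' : Lit) :
    resolve z ok l l' → resolve z ok l' l := by
  rintro ⟨h1, h2, h3⟩
  exact ⟨h _ _ h1, h3.symm, h2.symm⟩

theorem Lit.True_update {χ : ℕ → Bool} {z : ℕ} {b : Bool} {V : List ℕ} (hz : z ∉ V) {l : Lit}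
    (hl : l ∈ lits V) : Lit.True (Function.update χ z b) l ↔ Lit.True χ l := by
  rcases l with _ | ⟨y, b'⟩
  · rfl
  · have : y ≠ z := by
      rintro rfl
      exact hz (some_mem_lits.1 hl)
    simp [Lit.True, Function.update_of_ne this]

theorem mem_lits_cons {V : List ℕ} {z : ℕ} {l : Lit} :
    l ∈ lits (z :: V) ↔ l = some (z, true) ∨ l = some (z, false) ∨ l ∈ lits V := by
  simp only [lits, List.flatMap_cons, List.cons_append, List.nil_append, List.mem_cons]
  grind

/-- The resolvent of `l ∨ z` and `l' ∨ ¬z` is not imposed exactly when one of its parents is not;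
the conjuncts on `(z, z)` account for unit clauses, which strengthen every clause with the same
literal. -/
theorem satisfiable_cons {z : ℕ} {V : List ℕ} (hz : z ∉ V) {ok : Lit → Lit → Prop}
    (hsymm : ∀ l l', ok l l' → ok l' l) :
    Satisfiable ok (z :: V) ↔ Satisfiable (resolve z ok) V := by
  constructor
  · rintro ⟨χ, hχ⟩
    refine ⟨χ, fun l hl l' hl' => ?_⟩
    by_cases ht : Lit.True χ l ∨ Lit.True χ l'
    · exact .inr ht
    left
    rw [not_or] at ht
    have hm : ∀ {l}, l ∈ lits V → l ∈ lits (z :: V) := fun h => mem_lits_cons.2 (.inr (.inr h))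
    have hm' : ∀ b, some (z, b) ∈ lits (z :: V) := fun b => some_mem_lits.2 (by simp)
    have key : ∀ b, χ z = !b → ∀ l ∈ lits (z :: V), ¬ Lit.True χ l → ok l (some (z, b)) := by
      intro b hb l hl hn
      rcases hχ l hl _ (hm' b) with h | h | h
      · exact h
      · exact absurd h hn
      · simp [Lit.True, hb] at h
    have h0 := (hχ l (hm hl) l' (hm hl')).resolve_right (by tauto)
    rcases hb : χ z with _ | _
    · have h1 := key true hb
      have h2 := h1 _ (hm' true) (by simp [Lit.True, hb])
      exact ⟨h0, .inl ⟨h1 l (hm hl) ht.1, h2⟩, .inr ⟨h1 l' (hm hl') ht.2, h2⟩⟩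
    · have h1 := key false hb
      have h2 := h1 _ (hm' false) (by simp [Lit.True, hb])
      exact ⟨h0, .inr ⟨h1 l' (hm hl') ht.2, h2⟩, .inl ⟨h1 l (hm hl) ht.1, h2⟩⟩
  · rintro ⟨χ, hχ⟩
    -- The value of `z`: true unless some false `l₀` needs `¬z`. In that case the resolvents with
    -- `l₀` show that no false literal needs `z`.
    have key : ∃ b : Bool, ∀ l ∈ lits V, ¬ Lit.True χ l →
        ok l (some (z, !b)) ∧ ok (some (z, !b)) (some (z, !b)) := by
      by_cases hf : ∀ l ∈ lits V, ¬ Lit.True χ l →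
        ok l (some (z, false)) ∧ ok (some (z, false)) (some (z, false))
      · exact ⟨true, hf⟩
      · push Not at hf
        obtain ⟨l₀, hl₀, hn₀, h₀⟩ := hf
        refine ⟨false, fun l hl hn => ?_⟩
        obtain ⟨-, h, -⟩ := (hχ l hl l₀ hl₀).resolve_right (by tauto)
        exact h.resolve_right fun h => h₀ h.1 h.2
    obtain ⟨b, hb⟩ := key
    -- The literal `none` is always false, so it yields the unit clause on `z` alone.
    have hnn := (hb none (none_mem_lits V) (by simp [Lit.True])).2
    have hzz : ∀ b', b' ≠ b → b' = !b := by
      intro b' h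
      cases b <;> cases b' <;> simp_all
    have hz1 : ∀ l ∈ lits V, ∀ b', ok l (some (z, b')) ∨
        Lit.True (Function.update χ z b) l ∨ Lit.True (Function.update χ z b) (some (z, b')) := by
      intro l hl b'
      rw [Lit.True_update hz hl]
      by_cases ht : Lit.True χ l
      · tauto
      by_cases h' : b' = b
      · right; right; simp [Lit.True, h']
      · rw [hzz _ h']
        exact .inl (hb l hl ht).1
    have hz2 : ∀ b₁ b₂ : Bool, ok (some (z, b₁)) (some (z, b₂)) ∨
        Lit.True (Function.update χ z b) (some (z, b₁)) ∨
        Lit.True (Function.update χ z b) (some (z, b₂)) := by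
      intro b₁ b₂
      by_cases h₁ : b₁ = b
      · right; left; simp [Lit.True, h₁]
      by_cases h₂ : b₂ = b
      · right; right; simp [Lit.True, h₂]
      rw [hzz _ h₁, hzz _ h₂]
      exact .inl hnn
    have hz3 : ∀ l ∈ lits V, ∀ b', ok (some (z, b')) l ∨
        Lit.True (Function.update χ z b) (some (z, b')) ∨ Lit.True (Function.update χ z b) l := by
      intro l hl b'
      rcases hz1 l hl b' with h | h | h
      · exact .inl (hsymm _ _ h)
      · exact .inr (.inr h)
      · exact .inr (.inl h)
    refine ⟨Function.update χ z b, fun l hl l' hl' => ?_⟩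
    rw [mem_lits_cons] at hl hl'
    rcases hl with rfl | rfl | hl <;> rcases hl' with rfl | rfl | hl'
    · exact hz2 _ _
    · exact hz2 _ _
    · exact hz3 _ hl' _
    · exact hz2 _ _
    · exact hz2 _ _
    · exact hz3 _ hl' _
    · exact hz1 _ hl _
    · exact hz1 _ hl _
    · rw [Lit.True_update hz hl, Lit.True_update hz hl']
      exact (hχ l hl l' hl').imp_left And.left

/-- Elimination of the first `k` variables of `V`. -/
def eliminate (V : List ℕ) (ok : Lit → Lit → Prop) : ℕ → Lit → Lit → Prop
  | 0 => ok
  | k + 1 => resolve (V.getD k 0) (eliminate V ok k)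

theorem eliminate_symm {V : List ℕ} {ok : Lit → Lit → Prop} (hsymm : ∀ l l', ok l l' → ok l' l)
    (k : ℕ) : ∀ l l', eliminate V ok k l l' → eliminate V ok k l' l := by
  induction k with
  | zero => exact hsymm
  | succ k ih => exact resolve_symm ih

/-- Once all variables are gone, `none` is the only literal, and satisfiability means that the empty
clause `none ∨ none` is not imposed. -/
theorem satisfiable_iff_eliminate {V : List ℕ} (hV : V.Nodup) {ok : Lit → Lit → Prop}
    (hsymm : ∀ l l', ok l l' → ok l' l) :
    Satisfiable ok V ↔ eliminate V ok V.length none none := by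
  have key : ∀ k ≤ V.length,
      (Satisfiable ok V ↔ Satisfiable (eliminate V ok k) (V.drop k)) := by
    intro k
    induction k with
    | zero => simp [eliminate]
    | succ k ih =>
      intro hk
      rw [ih (by omega), List.drop_eq_getElem_cons (by omega)]
      have hnd : (V.drop k).Nodup := hV.sublist (List.drop_sublist k V)
      rw [List.drop_eq_getElem_cons (by omega : k < V.length), List.nodup_cons] at hnd
      rw [satisfiable_cons hnd.1 (eliminate_symm hsymm k)]
      simp [eliminate, List.getElem?_eq_getElem (by omega : k < V.length)]
  rw [key _ le_rfl, List.drop_length]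
  simp [Satisfiable, lits, Lit.True]

/-! ### Certain answers as satisfiability of 2-CNFs -/

/-- The variables of a query. -/
def CQ.vars (q : CQ) : List ℕ := (q.atoms.flatMap Atom.args).dedup

theorem CQ.mem_vars {q : CQ} {z : ℕ} : z ∈ q.vars ↔ ∃ α ∈ q.atoms, z ∈ α.args := by
  simp [CQ.vars]

/-- Co-occurrence of variables in an atom of a query. -/
def CQ.Cooccur (q : CQ) (z z' : ℕ) : Prop := ∃ α ∈ q.atoms, z ∈ α.args ∧ z' ∈ α.args

/-- A representative of the connected component of a variable in a query. -/
noncomputable def CQ.rep (q : CQ) (z : ℕ) : ℕ := (Quot.mk q.Cooccur z).out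

theorem CQ.rep_eq {q : CQ} {z z' : ℕ} (h : q.Cooccur z z') : q.rep z = q.rep z' := by
  rw [CQ.rep, CQ.rep, Quot.sound h]

theorem CQ.rep_rep (q : CQ) (z : ℕ) : q.rep (q.rep z) = q.rep z := by
  conv_lhs => rw [CQ.rep, CQ.rep, Quot.out_eq]
  rfl

/-- Co-occurrence is symmetric, so a property that propagates along it is invariant and descends to
the quotient. -/
theorem CQ.iff_of_rep_eq {q : CQ} {Q : ℕ → Prop} (hQ : ∀ z z', q.Cooccur z z' → Q z → Q z')
    {z z' : ℕ} (h : q.rep z = q.rep z') : Q z ↔ Q z' := by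
  have h' : Quot.mk q.Cooccur z = Quot.mk q.Cooccur z' := by
    rw [← Quot.out_eq (Quot.mk q.Cooccur z), ← Quot.out_eq (Quot.mk q.Cooccur z')]
    exact congrArg _ h
  have hs : ∀ x y, q.Cooccur x y → Q x = Q y := fun x y ⟨α, hα, h1, h2⟩ =>
    propext ⟨hQ x y ⟨α, hα, h1, h2⟩, hQ y x ⟨α, hα, h2, h1⟩⟩
  exact iff_of_eq (congrArg (Quot.lift Q hs) h')

/-- The atoms with the variable `z` hold in `M` when `z` is mapped to some element and all other
variables to the root. -/
def LocalMatch (q : CQ) (M : Pointed) (z : ℕ) : Prop :=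
  ∃ w, ∀ α ∈ q.atoms, z ∈ α.args → M.I.Sat (fun x => if x = z then w else M.a) α

/-- The connected component of `z` has no answer variables and can be mapped to `M`. -/
def CompMatch (q : CQ) (M : Pointed) (z : ℕ) : Prop :=
  (∀ i, q.rep (q.ans i) ≠ q.rep z) ∧
    ∃ δ : ℕ → M.D, ∀ β ∈ q.atoms, (∀ x ∈ β.args, q.rep x = q.rep z) → M.I.Sat δ β

theorem CompMatch.of_rep_eq {q : CQ} {M : Pointed} {z z' : ℕ} (h : q.rep z = q.rep z')
    (hz : CompMatch q M z) : CompMatch q M z' := by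
  simpa only [CompMatch, h] using hz

/-- The element `c` belongs to an atom of the data with a predicate of the ontology or query. -/
def InDom (gens : List (Atom Unit)) (q : CQ) (𝒜 : Data) (c : ℕ) : Prop :=
  ∃ α ∈ q.atoms ++ gens.map (fun g => g.at 0), ∃ τ : ℕ → ℕ, α.map τ ∈ 𝒜 ∧ ∃ x ∈ α.args, τ x = c

section

variable (gens : List (Atom Unit)) (C : Atom Unit → Pointed) (q : CQ) (𝒜 : Data) (σ : ℕ → ℕ)

/-- The variable `z` can be mapped to a null in the canonical model of an atom `g(σ z)`, with all
adjacent variables being mapped to `σ z`. -/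
def Null (z : ℕ) : Prop :=
  (∀ i, q.ans i ≠ z) ∧ (∀ z', q.Cooccur z z' → σ z = σ z') ∧
    ∃ g ∈ gens, LocalMatch q (C g) z ∧ g.at (σ z) ∈ 𝒜

/-- The atom `α` is in the data, or its component can be mapped to nulls. -/
def Direct (α : Atom ℕ) : Prop :=
  α.map σ ∈ 𝒜 ∨ ∃ g ∈ gens, CompMatch q (C g) α.fst ∧ g.at (σ α.fst) ∈ 𝒜

/-- The 2-clauses that are not imposed on the choice of the variables mapped to nulls. -/
def Ok : Lit → Lit → Prop
  | some (z, true), some (z', true) =>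
    ∀ α ∈ q.atoms, (∀ x ∈ α.args, x = z ∨ x = z') → Direct gens C q 𝒜 σ α
  | some (z, false), some (z', false) =>
    if z = z' then Null gens C q 𝒜 σ z else ¬ q.Cooccur z z'
  | _, _ => True

theorem ok_symm (l l' : Lit) : Ok gens C q 𝒜 σ l l' → Ok gens C q 𝒜 σ l' l := by
  rcases l with _ | ⟨z, _ | _⟩ <;> rcases l' with _ | ⟨z', _ | _⟩ <;> try exact id
  · simp only [Ok, eq_comm (a := z')]
    split_ifs with h
    · rw [h]; exact id
    · exact fun hn ⟨α, hα, h1, h2⟩ => hn ⟨α, hα, h2, h1⟩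
  · exact fun h α hα hx => h α hα fun x hx' => (hx x hx').symm

/-- Positive clauses express that atoms are accounted for, negative unit clauses that chosen
variables pass `Null`, and other negative clauses that neighbours are not both chosen. Mixed clauses
and those with `none` are never imposed at the start. -/
theorem satisfiable_ok :
    Satisfiable (Ok gens C q 𝒜 σ) q.vars ↔ ∃ χ : ℕ → Bool,
      (∀ z ∈ q.vars, χ z = true → Null gens C q 𝒜 σ z) ∧
      (∀ z z', z ≠ z' → q.Cooccur z z' → χ z = true → χ z' = false) ∧
      ∀ α ∈ q.atoms, Direct gens C q 𝒜 σ α ∨ ∃ z ∈ α.args, χ z = true := by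
  constructor
  · rintro ⟨χ, hχ⟩
    refine ⟨χ, fun z hz hc => ?_, fun z z' hne hco hc => ?_, fun α hα => ?_⟩
    · rcases hχ (some (z, false)) (some_mem_lits.2 hz)
        (some (z, false)) (some_mem_lits.2 hz) with h | h | h
      · simpa [Ok] using h
      · simp [Lit.True, hc] at h
      · simp [Lit.True, hc] at h
    · obtain ⟨α, hα, h1, h2⟩ := id hco
      rcases hχ (some (z, false)) (some_mem_lits.2 (CQ.mem_vars.2 ⟨α, hα, h1⟩))
        (some (z', false)) (some_mem_lits.2 (CQ.mem_vars.2 ⟨α, hα, h2⟩)) with h | h | h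
      · simp [Ok, hne, hco] at h
      · simp [Lit.True, hc] at h
      · exact h
    · obtain ⟨z, z', hz, hz', hx⟩ : ∃ z z', z ∈ α.args ∧ z' ∈ α.args ∧
          ∀ x ∈ α.args, x = z ∨ x = z' := by
        cases α with
        | un A t => exact ⟨t, t, by simp [Atom.args]⟩
        | bin P s t => exact ⟨s, t, by simp [Atom.args]⟩
      rcases hχ (some (z, true)) (some_mem_lits.2 (CQ.mem_vars.2 ⟨α, hα, hz⟩))
        (some (z', true)) (some_mem_lits.2 (CQ.mem_vars.2 ⟨α, hα, hz'⟩)) with h | h | h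
      · exact .inl (h α hα hx)
      · exact .inr ⟨z, hz, h⟩
      · exact .inr ⟨z', hz', h⟩
  · rintro ⟨χ, h1, h2, h3⟩
    refine ⟨χ, fun l hl l' hl' => ?_⟩
    by_cases ht : Lit.True χ l ∨ Lit.True χ l'
    · exact .inr ht
    left
    rw [not_or] at ht
    rcases l with _ | ⟨z, _ | _⟩ <;> rcases l' with _ | ⟨z', _ | _⟩ <;> try trivial
    · simp only [Lit.True, Bool.not_eq_false] at ht
      simp only [Ok]
      split_ifs with h
      · exact h1 z (some_mem_lits.1 hl) ht.1
      · intro hco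
        have := h2 z z' h hco ht.1
        simp [ht.2] at this
    · intro α hα hx
      refine (h3 α hα).resolve_right ?_
      rintro ⟨x, hx', hc⟩
      rcases hx x hx' with rfl | rfl
      · exact ht.1 hc
      · exact ht.2 hc

end

/-! ### Correctness of the 2-CNF encoding -/

section Certain

variable {T : Ontology} {C : Atom Unit → Pointed} {q : CQ} {𝒜 : Data}

/-- Universality carries the local matches in the pieces over to an arbitrary model, where they are
assembled into one match of the query. -/
theorem certainAnswer_of_satisfiable (hC : ∀ g ∈ T.gens, (C g).IsGen T g) {σ : ℕ → ℕ}
    (hsat : Satisfiable (Ok T.gens C q 𝒜 σ) q.vars) :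
    CertainAnswer T 𝒜 q fun i => σ (q.ans i) := by
  classical
  obtain ⟨χ, h1, h2, h3⟩ := (satisfiable_ok ..).1 hsat
  intro E J ι hJ
  -- One match is fixed per component, so that all its atoms agree on it. The individual `c` is
  -- arbitrary, since the component is not tied to it by an answer variable.
  have hcomp : ∀ ρ, ∃ δ : ℕ → E, (∃ c, ∃ g ∈ T.gens, CompMatch q (C g) ρ ∧ g.at c ∈ 𝒜) →
      ∀ β ∈ q.atoms, (∀ x ∈ β.args, q.rep x = q.rep ρ) → J.Sat δ β := by
    intro ρ
    by_cases h : ∃ c, ∃ g ∈ T.gens, CompMatch q (C g) ρ ∧ g.at c ∈ 𝒜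
    · obtain ⟨c, g, hg, ⟨-, δ, hδ⟩, hc⟩ := h
      obtain ⟨f, hf, -⟩ := (hC g hg).univ E J (ι c) hJ.1 ((J.sat_at g ι c).1 (hJ.2 _ hc))
      exact ⟨fun x => f (δ x), fun _ β hβ hx => hf.sat (hδ β hβ hx)⟩
    · exact ⟨fun _ => ι 0, fun h' => absurd h' h⟩
  choose δ hδ using hcomp
  have hnull : ∀ z, ∃ e : E, z ∈ q.vars → χ z = true → ∀ α ∈ q.atoms, z ∈ α.args →
      J.Sat (fun x => if x = z then e else ι (σ z)) α := by
    intro z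
    by_cases h : z ∈ q.vars ∧ χ z = true
    · obtain ⟨-, -, g, hg, ⟨w, hw⟩, hc⟩ := h1 z h.1 h.2
      obtain ⟨f, hf, ha⟩ := (hC g hg).univ E J (ι (σ z)) hJ.1 ((J.sat_at g ι _).1 (hJ.2 _ hc))
      refine ⟨f w, fun _ _ α hα hz => (Interp.sat_congr fun x _ => ?_).1 (hf.sat (hw α hα hz))⟩
      split_ifs
      · rfl
      · exact ha
    · exact ⟨ι 0, fun hz hc => absurd ⟨hz, hc⟩ h⟩
  choose e he using hnull
  -- Component matches take precedence: such a component is moved as a whole, even if some of its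
  -- atoms are in the data or contain chosen variables.
  let Anon (z : ℕ) : Prop := ∃ c, ∃ g ∈ T.gens, CompMatch q (C g) (q.rep z) ∧ g.at c ∈ 𝒜
  refine ⟨fun z => if Anon z then δ (q.rep z) z else if χ z = true then e z else ι (σ z), ?_, ?_⟩
  · intro i
    have hna : ¬ Anon (q.ans i) := by
      rintro ⟨c, g, -, ⟨h, -⟩, -⟩
      exact h i (q.rep_rep _).symm
    have hnc : ¬ χ (q.ans i) = true := fun hc =>
      (h1 _ (CQ.mem_vars.2 (q.ans_mem i)) hc).1 i rfl
    simp only [if_neg hna, if_neg hnc]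
  · intro α hα
    have hrep : ∀ x ∈ α.args, q.rep x = q.rep α.fst := fun x hx =>
      CQ.rep_eq ⟨α, hα, hx, α.fst_mem⟩
    have hanon : ∀ x ∈ α.args, Anon x ↔ Anon α.fst := fun x hx => by
      simp only [Anon, hrep x hx]
    by_cases hA : Anon α.fst
    · refine (Interp.sat_congr fun x hx => ?_).1
        (hδ (q.rep α.fst) hA α hα fun x hx => by rw [q.rep_rep, hrep x hx])
      rw [if_pos ((hanon x hx).2 hA), hrep x hx]
    by_cases hχ : ∃ z ∈ α.args, χ z = true
    · obtain ⟨z, hz, hc⟩ := hχ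
      have hzv : z ∈ q.vars := CQ.mem_vars.2 ⟨α, hα, hz⟩
      refine (Interp.sat_congr fun x hx => ?_).1 (he z hzv hc α hα hz)
      rw [if_neg (mt (hanon x hx).1 hA)]
      by_cases hxz : x = z
      · subst hxz
        simp [hc]
      · have hco : q.Cooccur z x := ⟨α, hα, hz, hx⟩
        simp [hxz, h2 z x (Ne.symm hxz) hco hc, (h1 z hzv hc).2.1 x hco]
    · rcases (h3 α hα).resolve_right hχ with h | ⟨g, hg, hcm, hc⟩
      · have := hJ.2 _ h
        rw [J.sat_map] at this
        refine (Interp.sat_congr fun x hx => ?_).1 this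
        rw [if_neg (mt (hanon x hx).1 hA), if_neg fun hc => hχ ⟨x, hx, hc⟩]
      · exact absurd ⟨_, g, hg, hcm.of_rep_eq (q.rep_rep _).symm, hc⟩ hA

/-- In a forest of depth at most 1, a child of the root is linked to the root only. -/
theorem forest_edge {D : Type} {I : Interp D} {a : D} {parent : D → Option D} {level : D → ℕ}
    (hl : ∀ u, level u ≤ 1) (hp : ∀ u v, parent u = some v → level v < level u)
    (he : ∀ P u v, I.bin P u v → (u = a ∧ v = a) ∨ parent u = some v ∨ parent v = some u)
    {P : ℕ} {d d' : D} (h : I.bin P d d' ∨ I.bin P d' d) (hd : parent d = some a) :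
    d' = a := by
  have h' : (d = a ∧ d' = a) ∨ parent d = some d' ∨ parent d' = some d := by
    rcases h with h | h
    · exact he _ _ _ h
    · have := he _ _ _ h
      tauto
  rcases h' with h' | h' | h'
  · exact h'.2
  · rw [hd] at h'
    exact (Option.some.inj h').symm
  · have h1 := hp _ _ hd
    have h2 := hp _ _ h'
    have h3 := hl d'
    omega

/-- A match `v` in the glued model is read off: `σ` takes the individual of each image, and the
chosen variables are those sent to children of the root of a copy. -/
theorem exists_satisfiable_of_certainAnswer (hA : IsComplete T 𝒜)
    (hC : ∀ g ∈ T.gens, (C g).IsGen T g) {c : Fin q.arity → ℕ} (hc : CertainAnswer T 𝒜 q c) :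
    ∃ σ : ℕ → ℕ, (∀ i, σ (q.ans i) = c i) ∧ (∀ z ∈ q.vars, InDom T.gens q 𝒜 (σ z)) ∧
      Satisfiable (Ok T.gens C q 𝒜 σ) q.vars := by
  classical
  obtain ⟨v, hans, hv⟩ := hc _ _ _ (glue_isModel hA hC)
  have hf : ∀ g, ∃ (parent : (C g).D → Option (C g).D) (level : (C g).D → ℕ), g ∈ T.gens →
      parent (C g).a = none ∧ (∀ u, level u ≤ 1) ∧
      (∀ u v, parent u = some v → level v < level u) ∧
      ∀ P u v, (C g).I.bin P u v →
        (u = (C g).a ∧ v = (C g).a) ∨ parent u = some v ∨ parent v = some u := by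
    intro g
    by_cases hg : g ∈ T.gens
    · obtain ⟨p, l, h⟩ := (hC g hg).forest
      exact ⟨p, l, fun _ => h⟩
    · exact ⟨fun _ => none, fun _ => 0, fun h => absurd h hg⟩
  choose parent level hforest using hf
  have hnull : ∀ {c : ℕ} {g : Atom Unit} {d : (C g).D} {z : ℕ} {α : Atom ℕ},
      v z = .inr (c, ⟨g, d⟩) → α ∈ q.atoms → z ∈ α.args → g ∈ T.gens ∧ g.at c ∈ 𝒜 ∧
        ∃ δ : ℕ → (C g).D, δ z = d ∧ d ≠ (C g).a ∧ (∀ x ∈ α.args, v x = emb C c g (δ x)) ∧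
          (C g).I.Sat δ α := by
    intro c g d z α hz hα hzα
    rcases glue_sat_cases (hv α hα) with ⟨h1, -⟩ | ⟨c', g', hg, hc, δ, h1, h2⟩
    · have := h1 z hzα
      rw [hz] at this
      simp at this
    · have := h1 z hzα
      rw [hz] at this
      obtain ⟨h3, rfl, rfl, h4⟩ := emb_eq_inr this.symm
      obtain rfl := eq_of_heq h4
      exact ⟨hg, hc, δ, rfl, h3, h1, h2⟩
  have hroot : ∀ {c : ℕ} {g : Atom Unit} {d : (C g).D} {x : ℕ}, v x = emb C c g d →
      root (v x) = c := by
    intro c g d x h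
    rw [h, root_emb]
  have hinr : ∀ {c : ℕ} {g : Atom Unit} {d : (C g).D}, d ≠ (C g).a →
      emb C c g d = .inr (c, ⟨g, d⟩) := by
    intro c g d h
    simp [emb, h]
  have hadj : ∀ {c : ℕ} {g : Atom Unit} {d : (C g).D} {z z' : ℕ},
      v z = .inr (c, ⟨g, d⟩) → q.Cooccur z z' → z ≠ z' → g ∈ T.gens ∧
        ∃ d', v z' = emb C c g d' ∧ ∃ P, (C g).I.bin P d d' ∨ (C g).I.bin P d' d := by
    intro c g d z z' hz ⟨α, hα, h1, h2⟩ hne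
    obtain ⟨hg, -, δ, rfl, -, h3, h4⟩ := hnull hz hα h1
    refine ⟨hg, δ z', h3 z' h2, ?_⟩
    cases α with
    | un A t => simp_all [Atom.args]
    | bin P s t =>
      refine ⟨P, ?_⟩
      simp only [Atom.args, List.mem_cons, List.not_mem_nil, or_false] at h1 h2
      rcases h1 with rfl | rfl <;> rcases h2 with rfl | rfl
      · exact absurd rfl hne
      · exact .inl h4
      · exact .inr h4
      · exact absurd rfl hne
  let χ (z : ℕ) : Prop := ∃ c g d, v z = .inr (c, ⟨g, d⟩) ∧ parent g d = some (C g).a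
  have hadj_root : ∀ {c : ℕ} {g : Atom Unit} {d : (C g).D} {z z' : ℕ},
      v z = .inr (c, ⟨g, d⟩) → parent g d = some (C g).a → q.Cooccur z z' → z ≠ z' →
        v z' = .inl c := by
    intro c g d z z' hz hd hco hne
    obtain ⟨hg, d', h1, P, h2⟩ := hadj hz hco hne
    obtain ⟨-, hl, hp, he⟩ := hforest g hg
    rw [h1, forest_edge hl hp he h2 hd, emb_root]
  refine ⟨fun z => root (v z), fun i => congrArg root (hans i), fun z hz => ?_,
    (satisfiable_ok ..).2 ⟨fun z => decide (χ z), ?_, ?_, ?_⟩⟩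
  · obtain ⟨α, hα, hzα⟩ := CQ.mem_vars.1 hz
    rcases glue_sat_cases (hv α hα) with ⟨-, h2⟩ | ⟨c, g, hg, hc, δ, h1, -⟩
    · exact ⟨α, by simp [hα], _, h2, z, hzα, rfl⟩
    · refine ⟨g.at 0, by simp only [List.mem_append, List.mem_map]; exact .inr ⟨g, hg, rfl⟩,
        fun _ => c, ?_, 0, (Atom.mem_args_at ..).2 rfl, (hroot (h1 z hzα)).symm⟩
      cases g <;> exact hc
  · intro z hz hc
    obtain ⟨c, g, d, h1, h2⟩ := of_decide_eq_true hc
    have hroot : root (v z) = c := by rw [h1]; rfl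
    obtain ⟨α, hα, hzα⟩ := CQ.mem_vars.1 hz
    obtain ⟨hg, hgc, -⟩ := hnull h1 hα hzα
    refine ⟨?_, ?_, g, hg, ⟨d, ?_⟩, by beta_reduce; rw [hroot]; exact hgc⟩
    · rintro i rfl
      rw [hans i] at h1
      simp at h1
    · intro z' hco
      by_cases hne : z = z'
      · rw [hne]
      · exact hroot.trans (congrArg root (hadj_root h1 h2 hco hne)).symm
    · intro β hβ hzβ
      obtain ⟨-, -, δ, h3, h4, h5, h6⟩ := hnull h1 hβ hzβ
      refine (Interp.sat_congr fun x hx => ?_).1 h6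
      split_ifs with hxz
      · rw [hxz, h3]
      · have := hadj_root h1 h2 ⟨β, hβ, hzβ, hx⟩ (Ne.symm hxz)
        exact (emb_eq_inl ((h5 x hx).symm.trans this)).2
  · intro z z' hne hco hc
    obtain ⟨c, g, d, h1, h2⟩ := of_decide_eq_true hc
    refine decide_eq_false ?_
    rintro ⟨c', g', d', h3, -⟩
    rw [hadj_root h1 h2 hco hne] at h3
    simp at h3
  · intro α hα
    rcases glue_sat_cases (hv α hα) with ⟨-, h⟩ | ⟨c, g, hg, hgc, δ, h1, h2⟩
    · exact .inl (.inl h)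
    obtain ⟨hpa, hl, hp, he⟩ := hforest g hg
    -- An atom of a copy lying entirely at its root is in the data by completeness.
    by_cases hall : ∀ x ∈ α.args, δ x = (C g).a
    · left; left
      refine mem_of_gen hA hC hg hgc ?_ ?_
      · rw [Interp.sat_map]
        exact (Interp.sat_congr hall).1 h2
      · intro x hx
        rw [Atom.args_map, List.mem_map] at hx
        obtain ⟨y, hy, rfl⟩ := hx
        exact hroot (h1 y hy)
    push Not at hall
    obtain ⟨z, hz, hza⟩ := hall
    by_cases hχ : parent g (δ z) = some (C g).a
    · exact .inr ⟨z, hz, decide_eq_true ⟨c, g, δ z, by rw [h1 z hz, hinr hza], hχ⟩⟩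
    left; right
    -- Nulls of this copy that are not children of its root have no edge to the root and, by depth
    -- 1, none to a child of the root. Hence `Q` spreads over the whole component.
    let Q (x : ℕ) : Prop := ∃ d, v x = .inr (c, ⟨g, d⟩) ∧ parent g d ≠ some (C g).a
    have hQ : ∀ x y, q.Cooccur x y → Q x → Q y := by
      rintro x y hco ⟨d, hd, hda⟩
      by_cases hxy : x = y
      · exact hxy ▸ ⟨d, hd, hda⟩
      obtain ⟨-, d', h3, P, h4⟩ := hadj hd hco hxy
      have hdne : d ≠ (C g).a := by
        obtain ⟨β, hβ, hxβ, -⟩ := hco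
        obtain ⟨-, -, -, -, h, -⟩ := hnull hd hβ hxβ
        exact h
      have hd' : d' ≠ (C g).a := by
        rintro rfl
        rcases h4 with h4 | h4 <;> rcases he _ _ _ h4 with h5 | h5 | h5 <;> simp_all
      refine ⟨d', by rw [h3, hinr hd'], fun h5 => hdne (forest_edge hl hp he (P := P) ?_ h5)⟩
      exact h4.symm
    have hQz : Q z := ⟨δ z, by rw [h1 z hz, hinr hza], hχ⟩
    have hQrep : ∀ x, q.rep x = q.rep α.fst → Q x := fun x hx =>
      (CQ.iff_of_rep_eq hQ (hx.trans (CQ.rep_eq ⟨α, hα, α.fst_mem, hz⟩))).2 hQz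
    refine ⟨g, hg, ⟨fun i hi => ?_, ?_⟩, by beta_reduce; rw [hroot (h1 _ α.fst_mem)]; exact hgc⟩
    · obtain ⟨d, hd, -⟩ := hQrep _ hi
      rw [hans i] at hd
      simp at hd
    · have : ∀ x, ∃ d, q.rep x = q.rep α.fst → v x = .inr (c, ⟨g, d⟩) := by
        intro x
        by_cases hx : q.rep x = q.rep α.fst
        · obtain ⟨d, hd, -⟩ := hQrep x hx
          exact ⟨d, fun _ => hd⟩
        · exact ⟨(C g).a, fun h => absurd h hx⟩
      choose ε hε using this
      refine ⟨ε, fun β hβ hx => ?_⟩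
      obtain ⟨-, -, δ', -, -, h3, h4⟩ := hnull (hε _ (hx _ β.fst_mem)) hβ β.fst_mem
      refine (Interp.sat_congr fun x hx' => ?_).1 h4
      have := h3 x hx'
      rw [hε x (hx x hx')] at this
      exact (eq_of_heq (emb_eq_inr this.symm).2.2.2)

end Certain

/-! ### Derivations -/

/-- An atom of the body of a clause holds under an assignment of its variables. -/
def Program.Holds (Pr : Program) (𝒜 : Data) (σ : ℕ → ℕ) : DAtom → Prop
  | .edb α => α.map σ ∈ 𝒜
  | .idb G xs => Pr.Entails 𝒜 G (xs.map σ)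

theorem Program.entails_iff {Pr : Program} {𝒜 : Data} {G : ℕ} {c : List ℕ} :
    Pr.Entails 𝒜 G c ↔ ∃ r ∈ Pr.clauses, ∃ σ, r.head = G ∧ r.headArgs.map σ = c ∧
      ∀ β ∈ r.body, Pr.Holds 𝒜 σ β := by
  constructor
  · rintro ⟨r, hr, σ, h1, h2⟩
    refine ⟨r, hr, σ, rfl, rfl, fun β hβ => ?_⟩
    cases β with
    | edb α => exact h1 α hβ
    | idb G xs => exact h2 G xs hβ
  · rintro ⟨r, hr, σ, rfl, rfl, h⟩
    exact .step r hr σ (fun α hα => h _ hα) (fun G xs hG => h _ hG)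

theorem Program.holds_congr {Pr : Program} {𝒜 : Data} {σ σ' : ℕ → ℕ} {β : DAtom}
    (h : ∀ x ∈ β.args, σ x = σ' x) : Pr.Holds 𝒜 σ β ↔ Pr.Holds 𝒜 σ' β := by
  cases β with
  | edb α =>
    simp only [Program.Holds]
    rw [Atom.map_congr h]
  | idb G xs =>
    simp only [Program.Holds]
    rw [show xs.map σ = xs.map σ' from List.map_congr_left h]

/-! ### The rewriting -/

/-- The intensional predicates of the rewriting: equality on the active domain, the goal, and the
gates of a monotone circuit for `Direct` and for the clauses obtained by resolution. -/
inductive Gate : Type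
  | eq : Gate
  | goal : Gate
  | direct (α : Atom ℕ) : Gate
  | ok (k : ℕ) (l l' : Lit) : Gate

/-- An injective description of gates. -/
def Gate.descr : Gate → List ℕ × Lit × Lit
  | .eq => ([0], none, none)
  | .goal => ([1], none, none)
  | .direct (.un A t) => ([2, A, t], none, none)
  | .direct (.bin P s t) => ([2, P, s, t], none, none)
  | .ok k l l' => ([3, k], l, l')

/-- The name of a gate. -/
def Gate.code (g : Gate) : ℕ := Encodable.encode g.descr

theorem Gate.code_injective : Function.Injective Gate.code := by
  refine Encodable.encode_injective.comp ?_
  rintro (_ | _ | ⟨_ | _⟩ | _) (_ | _ | ⟨_ | _⟩ | _) h <;> simp_all [Gate.descr]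

theorem Gate.code_inj {g g' : Gate} : g.code = g'.code ↔ g = g' := Gate.code_injective.eq_iff

/-- The rank of a gate in the dependence order. -/
def Gate.rank (n : ℕ) : Gate → ℕ
  | .eq => 0
  | .goal => n + 3
  | .direct _ => 1
  | .ok k _ _ => k + 2

/-- The arity of a gate. -/
def Gate.arity (q : CQ) : Gate → ℕ
  | .eq => 2
  | .goal => q.arity
  | .direct _ => q.vars.length
  | .ok _ _ _ => q.vars.length

/-- The atom of a gate applied to all variables of the query. -/
def Gate.atom (q : CQ) (g : Gate) : DAtom := .idb g.code q.vars

/-- Equality as an atom of a clause. -/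
def eqAtom (x y : ℕ) : DAtom := .idb Gate.eq.code [x, y]

/-- The arity of an intensional predicate. -/
def codeArity (q : CQ) (G : ℕ) : ℕ :=
  if G = Gate.eq.code then 2 else if G = Gate.goal.code then q.arity else q.vars.length

theorem codeArity_code (q : CQ) (g : Gate) : codeArity q g.code = g.arity q := by
  cases g <;> simp [codeArity, Gate.code_inj, Gate.arity]

theorem CQ.ans_mem_vars (q : CQ) (i : Fin q.arity) : q.ans i ∈ q.vars :=
  CQ.mem_vars.2 (q.ans_mem i)

section Rewriting

variable (gens : List (Atom Unit)) (C : Atom Unit → Pointed) (q : CQ)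

open Classical in
/-- The bodies of the clauses for `Ok`. -/
noncomputable def okBodies : Lit → Lit → List (List DAtom)
  | some (z, true), some (z', true) =>
    [(q.atoms.filter fun α => ∀ x ∈ α.args, x = z ∨ x = z').map fun α => (Gate.direct α).atom q]
  | some (z, false), some (z', false) =>
    if z = z' then
      if ∀ i, q.ans i ≠ z then
        (gens.filter fun g => LocalMatch q (C g) z).map fun g =>
          .edb (g.at z) :: (q.vars.filter fun z' => q.Cooccur z z').map (eqAtom z)
      -- No body at all means false; a single empty body means true.
      else []
    else if q.Cooccur z z' then [] else [[]]
  | _, _ => [[]]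

open Classical in
/-- The bodies of the clauses for a gate, except for the restriction to the active domain. -/
noncomputable def bodies : Gate → List (List DAtom)
  | .eq => []
  | .goal => []
  | .direct α => [.edb α] ::
      (gens.filter fun g => CompMatch q (C g) α.fst).map fun g => [.edb (g.at α.fst)]
  | .ok 0 l l' => okBodies gens C q l l'
  | .ok (k + 1) l l' =>
    let a (l l' : Lit) : DAtom := (Gate.ok k l l').atom q
    let z : Lit := some (q.vars.getD k 0, true)
    let z' : Lit := some (q.vars.getD k 0, false)
    -- The two disjunctions in `resolve`, multiplied out; constantly many bodies of constant length.
    [[a l l', a l z, a z z, a l z', a z' z'], [a l l', a l z, a z z, a l' z, a z z],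
      [a l l', a l' z', a z' z', a l z', a z' z'], [a l l', a l' z', a z' z', a l' z, a z z]]

/-- The gates of the circuit. -/
def gates : List Gate :=
  q.atoms.map .direct ++ (List.range (q.vars.length + 1)).flatMap fun k =>
    (lits q.vars).flatMap fun l => (lits q.vars).map fun l' => .ok k l l'

theorem direct_mem_gates {q : CQ} {α : Atom ℕ} : .direct α ∈ gates q ↔ α ∈ q.atoms := by
  simp [gates]

theorem ok_mem_gates {q : CQ} {k : ℕ} {l l' : Lit} : .ok k l l' ∈ gates q ↔
    k ≤ q.vars.length ∧ l ∈ lits q.vars ∧ l' ∈ lits q.vars := by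
  simp [gates]

theorem eq_notMem_gates {q : CQ} : .eq ∉ gates q := by simp [gates]

theorem goal_notMem_gates {q : CQ} : .goal ∉ gates q := by simp [gates]

/-- The restriction of all variables to the active domain. -/
def domAtoms : List DAtom := q.vars.map fun x => eqAtom x x

/-- The clause for equality given by an argument of an atom. -/
def eqClause (α : Atom ℕ) (x : {x // x ∈ α.args}) : Clause where
  head := Gate.eq.code
  headArgs := [x, x]
  body := [.edb α]
  safe := fun y hy => ⟨_, List.mem_singleton_self _, by
    have h : y = x := by simpa using hy
    exact h ▸ x.2⟩

/-- The clauses for equality. -/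
def eqClauses : List Clause :=
  (q.atoms ++ gens.map fun g : Atom Unit => g.at 0).flatMap fun α : Atom ℕ =>
    α.args.attach.map (eqClause α)

/-- The clause for the goal. -/
def goalClause : Clause where
  head := Gate.goal.code
  headArgs := List.ofFn q.ans
  body := (Gate.ok q.vars.length none none).atom q :: domAtoms q
  safe := fun x hx => ⟨_, List.mem_cons_self, by
    obtain ⟨i, rfl⟩ := (List.mem_ofFn' ..).1 hx
    exact q.ans_mem_vars i⟩

/-- The clauses for the other gates. -/
noncomputable def gateClauses : List Clause :=
  (gates q).flatMap fun g => (bodies gens C q g).map fun b =>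
    { head := g.code
      headArgs := q.vars
      body := b ++ domAtoms q
      -- A body may omit variables or be empty; the domain atoms keep the clause safe.
      safe := fun x hx => ⟨eqAtom x x,
        List.mem_append_right _ (List.mem_map_of_mem (f := fun x => eqAtom x x) hx),
        List.mem_cons_self⟩ }

variable {gens C q}

/-- The variables and predicates that occur in the bodies for gates. -/
theorem bodies_spec {g : Gate} {b : List DAtom} (hg : g ∈ gates q) (hb : b ∈ bodies gens C q g)
    {β : DAtom} (hβ : β ∈ b) : (∀ x ∈ β.args, x ∈ q.vars) ∧ β.args.length ≤ q.vars.length + 2 ∧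
      ∀ G xs, β = .idb G xs → ∃ g' : Gate, G = g'.code ∧ g'.rank q.vars.length <
        g.rank q.vars.length ∧ xs.length = g'.arity q := by
  have hedb : ∀ α : Atom ℕ, (∀ x ∈ α.args, x ∈ q.vars) → β = .edb α →
      (∀ x ∈ β.args, x ∈ q.vars) ∧ β.args.length ≤ q.vars.length + 2 ∧
      ∀ G xs, β = .idb G xs → ∃ g' : Gate, G = g'.code ∧ g'.rank q.vars.length <
        g.rank q.vars.length ∧ xs.length = g'.arity q := by
    rintro α hα rfl
    refine ⟨hα, ?_, fun G xs h => by simp at h⟩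
    cases α <;> simp [DAtom.args, Atom.args]
  have hat : ∀ (g₀ : Atom Unit) (z : ℕ), z ∈ q.vars → ∀ x ∈ (g₀.at z).args, x ∈ q.vars :=
    fun g₀ z hz x hx => ((Atom.mem_args_at ..).1 hx).symm ▸ hz
  have hidb : ∀ g' : Gate, g'.rank q.vars.length < g.rank q.vars.length →
      q.vars.length = g'.arity q → β = g'.atom q →
      (∀ x ∈ β.args, x ∈ q.vars) ∧ β.args.length ≤ q.vars.length + 2 ∧
      ∀ G xs, β = .idb G xs → ∃ g' : Gate, G = g'.code ∧ g'.rank q.vars.length <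
        g.rank q.vars.length ∧ xs.length = g'.arity q := by
    rintro g' h1 h2 rfl
    refine ⟨fun x hx => hx, by simp [Gate.atom, DAtom.args], fun G xs h => ?_⟩
    simp only [Gate.atom, DAtom.idb.injEq] at h
    exact ⟨g', h.1.symm, h1, by rw [← h.2]; exact h2⟩
  rcases g with _ | _ | α | ⟨_ | k, l, l'⟩
  · simp [bodies] at hb
  · simp [bodies] at hb
  · have hα : ∀ x ∈ α.args, x ∈ q.vars := fun x hx =>
      CQ.mem_vars.2 ⟨α, direct_mem_gates.1 hg, hx⟩
    simp only [bodies, List.mem_cons, List.mem_map] at hb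
    rcases hb with rfl | ⟨g₀, -, rfl⟩
    · exact hedb α hα (by simpa using hβ)
    · exact hedb _ (hat g₀ _ (hα _ α.fst_mem)) (by simpa using hβ)
  · obtain ⟨-, hl, hl'⟩ := ok_mem_gates.1 hg
    simp only [bodies] at hb
    rcases l with _ | ⟨z, _ | _⟩ <;> rcases l' with _ | ⟨z', _ | _⟩ <;>
      simp only [okBodies, List.mem_singleton] at hb <;> try (subst hb; simp at hβ)
    · have hz := some_mem_lits.1 hl
      split_ifs at hb with h1 h2 h3
      · simp only [List.mem_map] at hb
        obtain ⟨g₀, -, rfl⟩ := hb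
        simp only [List.mem_cons, List.mem_map, List.mem_filter] at hβ
        rcases hβ with hβ | ⟨y, ⟨hy, -⟩, rfl⟩
        · exact hedb _ (hat g₀ _ hz) hβ
        · refine ⟨?_, by simp [eqAtom, DAtom.args], fun G xs h => ?_⟩
          · intro x hx
            simp only [eqAtom, DAtom.args, List.mem_cons, List.not_mem_nil, or_false] at hx
            rcases hx with rfl | rfl
            · exact hz
            · exact hy
          · simp only [eqAtom, DAtom.idb.injEq] at h
            exact ⟨.eq, h.1.symm, by simp [Gate.rank], by rw [← h.2]; rfl⟩
      · simp at hb
      · simp at hb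
      · simp only [List.mem_singleton] at hb
        subst hb
        simp at hβ
    · obtain ⟨α, -, rfl⟩ := hβ
      exact hidb _ (by simp [Gate.rank]) rfl rfl
  · have : ∃ l l', β = (Gate.ok k l l').atom q := by
      simp only [bodies, List.mem_cons, List.not_mem_nil, or_false] at hb
      rcases hb with rfl | rfl | rfl | rfl <;>
        simp only [List.mem_cons, List.not_mem_nil, or_false] at hβ <;>
        rcases hβ with h | h | h | h | h <;> exact ⟨_, _, h⟩
    obtain ⟨l, l', h⟩ := this
    exact hidb _ (by simp [Gate.rank]) rfl h

theorem mem_eqClauses {r : Clause} (h : r ∈ eqClauses gens q) :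
    ∃ α ∈ q.atoms ++ gens.map (fun g => g.at 0), ∃ x ∈ α.args,
      r.head = Gate.eq.code ∧ r.headArgs = [x, x] ∧ r.body = [.edb α] := by
  simp only [eqClauses, List.mem_flatMap, List.mem_map] at h
  obtain ⟨α, hα, x, -, rfl⟩ := h
  exact ⟨α, hα, x.1, x.2, rfl, rfl, rfl⟩

theorem exists_mem_eqClauses {α : Atom ℕ} (hα : α ∈ q.atoms ++ gens.map (fun g => g.at 0))
    {x : ℕ} (hx : x ∈ α.args) : ∃ r ∈ eqClauses gens q,
      r.head = Gate.eq.code ∧ r.headArgs = [x, x] ∧ r.body = [.edb α] :=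
  ⟨_, List.mem_flatMap.2 ⟨α, hα, List.mem_map.2 ⟨⟨x, hx⟩, by simp, rfl⟩⟩, rfl, rfl, rfl⟩

theorem mem_gateClauses {r : Clause} (h : r ∈ gateClauses gens C q) :
    ∃ g ∈ gates q, ∃ b ∈ bodies gens C q g,
      r.head = g.code ∧ r.headArgs = q.vars ∧ r.body = b ++ domAtoms q := by
  simp only [gateClauses, List.mem_flatMap, List.mem_map] at h
  obtain ⟨g, hg, b, hb, rfl⟩ := h
  exact ⟨g, hg, b, hb, rfl, rfl, rfl⟩

theorem exists_mem_gateClauses {g : Gate} (hg : g ∈ gates q) {b : List DAtom}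
    (hb : b ∈ bodies gens C q g) : ∃ r ∈ gateClauses gens C q,
      r.head = g.code ∧ r.headArgs = q.vars ∧ r.body = b ++ domAtoms q :=
  ⟨_, List.mem_flatMap.2 ⟨g, hg, List.mem_map.2 ⟨b, hb, rfl⟩⟩, rfl, rfl, rfl⟩

theorem Gate.arity_of_mem {g : Gate} (hg : g ∈ gates q) : g.arity q = q.vars.length := by
  cases g
  · exact absurd hg eq_notMem_gates
  · exact absurd hg goal_notMem_gates
  · rfl
  · rfl

theorem Gate.rank_pos_of_mem {g : Gate} (hg : g ∈ gates q) (n : ℕ) : 0 < g.rank n := by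
  cases g
  · exact absurd hg eq_notMem_gates
  all_goals simp [Gate.rank]

theorem idb_mem_domAtoms {G : ℕ} {xs : List ℕ} (h : DAtom.idb G xs ∈ domAtoms q) :
    G = Gate.eq.code ∧ xs.length = 2 := by
  simp only [domAtoms, List.mem_map, eqAtom, DAtom.idb.injEq] at h
  obtain ⟨x, -, rfl, rfl⟩ := h
  exact ⟨rfl, rfl⟩

variable (gens C q)

/-- The list of all clauses of the rewriting. -/
noncomputable def clauses : List Clause :=
  eqClauses gens q ++ goalClause q :: gateClauses gens C q

variable {gens C q}

/-- The arity equations make the program well formed, and the strict decrease of `Gate.rank` from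
head to body makes it nonrecursive. -/
theorem clauses_spec {r : Clause} (hr : r ∈ clauses gens C q) :
    ∃ g : Gate, r.head = g.code ∧ r.headArgs.length = g.arity q ∧
      ∀ G xs, DAtom.idb G xs ∈ r.body → ∃ g' : Gate, G = g'.code ∧
        g'.rank q.vars.length < g.rank q.vars.length ∧ xs.length = g'.arity q := by
  simp only [clauses, List.mem_append, List.mem_cons] at hr
  rcases hr with hr | rfl | hr
  · obtain ⟨α, -, x, -, h1, h2, h3⟩ := mem_eqClauses hr
    refine ⟨.eq, h1, by rw [h2]; rfl, fun G xs h => ?_⟩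
    rw [h3] at h
    simp at h
  · refine ⟨.goal, rfl, by simp [goalClause, Gate.arity], fun G xs h => ?_⟩
    simp only [goalClause, List.mem_cons] at h
    rcases h with h | h
    · simp only [Gate.atom, DAtom.idb.injEq] at h
      exact ⟨_, h.1, by simp [Gate.rank], by rw [h.2]; rfl⟩
    · obtain ⟨h1, h2⟩ := idb_mem_domAtoms h
      exact ⟨.eq, h1, by simp [Gate.rank], h2⟩
  · obtain ⟨g, hg, b, hb, h1, h2, h3⟩ := mem_gateClauses hr
    refine ⟨g, h1, by rw [h2, Gate.arity_of_mem hg], fun G xs h => ?_⟩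
    rw [h3, List.mem_append] at h
    rcases h with h | h
    · exact (bodies_spec hg hb h).2.2 G xs rfl
    · obtain ⟨h1, h2⟩ := idb_mem_domAtoms h
      exact ⟨.eq, h1, Gate.rank_pos_of_mem hg _, h2⟩

variable (gens C q)

/-- The rewriting. -/
noncomputable def rewriting : Program where
  clauses := clauses gens C q
  arity := codeArity q
  head_arity := fun r hr => by
    obtain ⟨g, h1, h2, -⟩ := clauses_spec hr
    rw [h1, h2, codeArity_code]
  body_arity := fun r hr G xs h => by
    obtain ⟨_, -, -, h3⟩ := clauses_spec hr
    obtain ⟨g', rfl, -, h4⟩ := h3 G xs h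
    rw [h4, codeArity_code]

theorem rewriting_nonrecursive : (rewriting gens C q).Nonrecursive := by
  have key : ∀ G G', Relation.TransGen (rewriting gens C q).Depends G G' →
      ∃ g g' : Gate, G = g.code ∧ G' = g'.code ∧
        g'.rank q.vars.length < g.rank q.vars.length := by
    have step : ∀ G G', (rewriting gens C q).Depends G G' →
        ∃ g g' : Gate, G = g.code ∧ G' = g'.code ∧
          g'.rank q.vars.length < g.rank q.vars.length := by
      rintro G G' ⟨r, hr, rfl, xs, hxs⟩
      obtain ⟨g, h1, -, h3⟩ := clauses_spec hr
      obtain ⟨g', h4, h5, -⟩ := h3 G' xs hxs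
      exact ⟨g, g', h1, h4, h5⟩
    intro G G' h
    induction h with
    | single h => exact step _ _ h
    | tail _ h ih =>
      obtain ⟨g₁, g₂, h1, h2, h3⟩ := ih
      obtain ⟨g₃, g₄, h4, h5, h6⟩ := step _ _ h
      obtain rfl := Gate.code_injective (h2.symm.trans h4)
      exact ⟨g₁, g₄, h1, h5, h6.trans h3⟩
  intro G h
  obtain ⟨g, g', h1, h2, h3⟩ := key G G h
  obtain rfl := Gate.code_injective (h1.symm.trans h2)
  exact lt_irrefl _ h3

/-! ### Evaluation of the program on data -/

variable {gens C q} {𝒜 : Data}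

/-- Clauses lack equality, so it is simulated on the constants in atoms over the signature. This
loses nothing, since `σ` can always be taken with values there. -/
theorem entails_eq {a b : ℕ} :
    (rewriting gens C q).Entails 𝒜 Gate.eq.code [a, b] ↔ a = b ∧ InDom gens q 𝒜 a := by
  rw [Program.entails_iff]
  constructor
  · rintro ⟨r, hr, σ, h1, h2, h3⟩
    simp only [rewriting, clauses, List.mem_append, List.mem_cons] at hr
    rcases hr with hr | rfl | hr
    · obtain ⟨α, hα, x, hx, -, h5, h6⟩ := mem_eqClauses hr
      rw [h5] at h2
      simp only [List.map_cons, List.map_nil, List.cons.injEq, and_true] at h2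
      obtain ⟨rfl, rfl⟩ := h2
      exact ⟨rfl, α, hα, σ, h3 (.edb α) (by rw [h6]; simp), x, hx, rfl⟩
    · simp [goalClause, Gate.code_inj] at h1
    · obtain ⟨g, hg, -, -, h4, -⟩ := mem_gateClauses hr
      rw [h4, Gate.code_inj] at h1
      exact absurd (h1 ▸ hg) eq_notMem_gates
  · rintro ⟨rfl, α, hα, τ, h1, x, hx, rfl⟩
    obtain ⟨r, hr, h2, h3, h4⟩ := exists_mem_eqClauses hα hx
    refine ⟨r, List.mem_append_left _ hr, τ, h2, by rw [h3]; rfl, fun β hβ => ?_⟩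
    rw [h4, List.mem_singleton] at hβ
    rw [hβ]
    exact h1

theorem holds_domAtoms {σ : ℕ → ℕ} :
    (∀ β ∈ domAtoms q, (rewriting gens C q).Holds 𝒜 σ β) ↔
      ∀ x ∈ q.vars, InDom gens q 𝒜 (σ x) := by
  simp [domAtoms, eqAtom, Program.Holds, entails_eq]

/-- The head lists all query variables and the bodies use no others, so a derivation is forced to
use `σ`; the domain atoms hold by `hσ`. -/
theorem entails_gate {g : Gate} (hg : g ∈ gates q) {σ : ℕ → ℕ}
    (hσ : ∀ x ∈ q.vars, InDom gens q 𝒜 (σ x)) :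
    (rewriting gens C q).Entails 𝒜 g.code (q.vars.map σ) ↔
      ∃ b ∈ bodies gens C q g, ∀ β ∈ b, (rewriting gens C q).Holds 𝒜 σ β := by
  rw [Program.entails_iff]
  constructor
  · rintro ⟨r, hr, τ, h1, h2, h3⟩
    simp only [rewriting, clauses, List.mem_append, List.mem_cons] at hr
    rcases hr with hr | rfl | hr
    · obtain ⟨-, -, -, -, h4, -⟩ := mem_eqClauses hr
      rw [h4, Gate.code_inj] at h1
      exact absurd (h1 ▸ hg) eq_notMem_gates
    · simp only [goalClause, Gate.code_inj] at h1
      exact absurd (h1 ▸ hg) goal_notMem_gates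
    · obtain ⟨g', -, b, hb, h4, h5, h6⟩ := mem_gateClauses hr
      rw [h4, Gate.code_inj] at h1
      subst h1
      rw [h5] at h2
      refine ⟨b, hb, fun β hβ => ?_⟩
      refine (Program.holds_congr fun x hx => ?_).1 (h3 β (by rw [h6]; simp [hβ]))
      exact List.map_inj_left.1 h2 x ((bodies_spec hg hb hβ).1 x hx)
  · rintro ⟨b, hb, h⟩
    obtain ⟨r, hr, h1, h2, h3⟩ := exists_mem_gateClauses hg hb
    refine ⟨r, by simp [rewriting, clauses, hr], σ, h1, by rw [h2], fun β hβ => ?_⟩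
    rw [h3, List.mem_append] at hβ
    rcases hβ with hβ | hβ
    · exact h β hβ
    · exact holds_domAtoms.2 hσ β hβ

theorem entails_direct {α : Atom ℕ} (hα : α ∈ q.atoms) {σ : ℕ → ℕ}
    (hσ : ∀ x ∈ q.vars, InDom gens q 𝒜 (σ x)) :
    (rewriting gens C q).Entails 𝒜 (Gate.direct α).code (q.vars.map σ) ↔
      Direct gens C q 𝒜 σ α := by
  have hat : ∀ g : Atom Unit, (g.at α.fst).map σ = g.at (σ α.fst) := by
    intro g
    cases g <;> rfl
  rw [entails_gate (direct_mem_gates.2 hα) hσ]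
  simp [bodies, Direct, Program.Holds, hat, and_assoc]

theorem entails_ok_zero {l l' : Lit} (hl : l ∈ lits q.vars) (hl' : l' ∈ lits q.vars) {σ : ℕ → ℕ}
    (hσ : ∀ x ∈ q.vars, InDom gens q 𝒜 (σ x)) :
    (rewriting gens C q).Entails 𝒜 (Gate.ok 0 l l').code (q.vars.map σ) ↔
      Ok gens C q 𝒜 σ l l' := by
  rw [entails_gate (ok_mem_gates.2 ⟨Nat.zero_le _, hl, hl'⟩) hσ]
  simp only [bodies]
  rcases l with _ | ⟨z, _ | _⟩ <;> rcases l' with _ | ⟨z', _ | _⟩ <;>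
    simp only [okBodies, Ok] <;> try simp
  · have hz := some_mem_lits.1 hl
    have hat : ∀ g : Atom Unit, (g.at z).map σ = g.at (σ z) := by
      intro g
      cases g <;> rfl
    have hco : ∀ y, q.Cooccur z y → y ∈ q.vars := fun y ⟨α, hα, _, hy⟩ =>
      CQ.mem_vars.2 ⟨α, hα, hy⟩
    split_ifs with h1 h2 h3
    · simp only [Null, List.mem_map, List.mem_filter, decide_eq_true_eq]
      constructor
      · rintro ⟨-, ⟨g, ⟨hg, hm⟩, rfl⟩, h⟩
        refine ⟨h2, fun y hy => ?_, g, hg, hm, ?_⟩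
        · have := h (eqAtom z y) (List.mem_cons_of_mem _ (List.mem_map_of_mem (by simp [hy, hco y hy])))
          exact (entails_eq.1 this).1
        · rw [← hat]
          exact h _ List.mem_cons_self
      · rintro ⟨-, h4, g, hg, hm, h5⟩
        refine ⟨_, ⟨g, ⟨hg, hm⟩, rfl⟩, fun β hβ => ?_⟩
        simp only [List.mem_cons, List.mem_map, List.mem_filter, decide_eq_true_eq] at hβ
        rcases hβ with rfl | ⟨y, ⟨-, hy⟩, rfl⟩
        · rw [← hat] at h5
          exact h5
        · exact entails_eq.2 ⟨h4 y hy, hσ z hz⟩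
    · simp only [List.not_mem_nil, false_and, exists_false, false_iff]
      exact fun h => h2 h.1
    · simp [h3]
    · simp [h3]
  · constructor
    · exact fun h α hα hx => (entails_direct hα hσ).1 (h _ α hα hx rfl)
    · rintro h _ α hα hx rfl
      exact (entails_direct hα hσ).2 (h α hα hx)

theorem entails_ok {σ : ℕ → ℕ} (hσ : ∀ x ∈ q.vars, InDom gens q 𝒜 (σ x)) {k : ℕ}
    (hk : k ≤ q.vars.length) : ∀ {l l' : Lit}, l ∈ lits q.vars → l' ∈ lits q.vars →
    ((rewriting gens C q).Entails 𝒜 (Gate.ok k l l').code (q.vars.map σ) ↔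
      eliminate q.vars (Ok gens C q 𝒜 σ) k l l') := by
  induction k with
  | zero => exact fun hl hl' => entails_ok_zero hl hl' hσ
  | succ k ih =>
    intro l l' hl hl'
    have hz : ∀ b, some (q.vars.getD k 0, b) ∈ lits q.vars := fun b => by
      rw [some_mem_lits, List.getD_eq_getElem _ _ (by omega)]
      exact List.getElem_mem _
    have ih' := fun {l l'} => @ih (by omega) l l'
    rw [entails_gate (ok_mem_gates.2 ⟨hk, hl, hl'⟩) hσ]
    simp only [bodies, Gate.atom, List.mem_cons, List.not_mem_nil, or_false, forall_eq_or_imp,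
      forall_eq, exists_eq_or_imp, exists_eq_left, Program.Holds, eliminate, resolve,
      ih' hl hl', ih' hl (hz _), ih' hl' (hz _), ih' (hz _) (hz _)]
    tauto

/-- Only here are the non-answer variables projected away: a derivation of the goal guesses `σ`, and
the circuit then decides the 2-CNF. -/
theorem entails_goal {c : Fin q.arity → ℕ} :
    (rewriting gens C q).Entails 𝒜 Gate.goal.code (List.ofFn c) ↔
      ∃ σ : ℕ → ℕ, (∀ i, σ (q.ans i) = c i) ∧ (∀ x ∈ q.vars, InDom gens q 𝒜 (σ x)) ∧
        Satisfiable (Ok gens C q 𝒜 σ) q.vars := by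
  have key : ∀ σ : ℕ → ℕ, (∀ x ∈ q.vars, InDom gens q 𝒜 (σ x)) →
      ((rewriting gens C q).Holds 𝒜 σ ((Gate.ok q.vars.length none none).atom q) ↔
        Satisfiable (Ok gens C q 𝒜 σ) q.vars) := by
    intro σ hσ
    rw [satisfiable_iff_eliminate (V := q.vars) (List.nodup_dedup _) (ok_symm gens C q 𝒜 σ)]
    exact entails_ok hσ le_rfl (none_mem_lits _) (none_mem_lits _)
  have hans : ∀ σ : ℕ → ℕ, (List.ofFn q.ans).map σ = List.ofFn c ↔ ∀ i, σ (q.ans i) = c i := by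
    intro σ
    rw [List.map_ofFn, List.ofFn_inj]
    exact funext_iff
  rw [Program.entails_iff]
  constructor
  · rintro ⟨r, hr, σ, h1, h2, h3⟩
    simp only [rewriting, clauses, List.mem_append, List.mem_cons] at hr
    rcases hr with hr | rfl | hr
    · obtain ⟨-, -, -, -, h4, -⟩ := mem_eqClauses hr
      simp [h4, Gate.code_inj] at h1
    · have hσ := holds_domAtoms.1 fun β hβ => h3 β (List.mem_cons_of_mem _ hβ)
      exact ⟨σ, (hans σ).1 h2, hσ, (key σ hσ).1 (h3 _ List.mem_cons_self)⟩
    · obtain ⟨g, hg, -, -, h4, -⟩ := mem_gateClauses hr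
      rw [h4, Gate.code_inj] at h1
      exact absurd (h1 ▸ hg) goal_notMem_gates
  · rintro ⟨σ, h1, hσ, h2⟩
    refine ⟨goalClause q, by simp [rewriting, clauses], σ, rfl, (hans σ).2 h1, fun β hβ => ?_⟩
    rcases List.mem_cons.1 hβ with rfl | hβ
    · exact (key σ hσ).2 h2
    · exact holds_domAtoms.2 hσ β hβ

end Rewriting

theorem isNDLRewriting_rewriting {T : Ontology} {C : Atom Unit → Pointed}
    (hC : ∀ g ∈ T.gens, (C g).IsGen T g) (q : CQ) :
    IsNDLRewriting T q (rewriting T.gens C q) Gate.goal.code := by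
  refine ⟨rewriting_nonrecursive _ _ _, codeArity_code q .goal, fun 𝒜 hA c _ => ?_⟩
  rw [entails_goal]
  constructor
  · exact exists_satisfiable_of_certainAnswer hA hC
  · rintro ⟨σ, h1, -, h2⟩
    have := certainAnswer_of_satisfiable hC h2
    rwa [funext h1] at this

/-! ### The size of the rewriting -/

theorem sum_map_le {ι : Type} {l : List ι} {f : ι → ℕ} {N B : ℕ} (hl : l.length ≤ N)
    (h : ∀ x ∈ l, f x ≤ B) : (l.map f).sum ≤ N * B := by
  have := List.sum_le_card_nsmul (l.map f) B (by simpa using h)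
  rw [List.length_map, smul_eq_mul] at this
  exact this.trans (Nat.mul_le_mul_right B hl)

theorem length_flatMap_le {ι κ : Type} {l : List ι} {f : ι → List κ} {N B : ℕ}
    (hl : l.length ≤ N) (h : ∀ x ∈ l, (f x).length ≤ B) : (l.flatMap f).length ≤ N * B := by
  rw [List.length_flatMap]
  exact sum_map_le hl h

theorem Atom.length_args_le {τ : Type} (α : Atom τ) : α.args.length ≤ 2 := by
  cases α <;> simp [Atom.args]

theorem CQ.length_atoms_le (q : CQ) : q.atoms.length ≤ q.size := by
  have : (q.atoms.map fun _ => 1).sum ≤ (q.atoms.map fun α => 1 + α.args.length).sum :=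
    List.sum_le_sum fun α _ => Nat.le_add_right _ _
  simp only [List.map_const', List.sum_replicate, smul_eq_mul, mul_one] at this
  unfold CQ.size
  omega

theorem CQ.length_vars_le (q : CQ) : q.vars.length ≤ q.size := by
  have h1 : q.vars.length ≤ (q.atoms.flatMap Atom.args).length :=
    (List.dedup_sublist _).length_le
  rw [List.length_flatMap] at h1
  have : (q.atoms.map fun α => α.args.length).sum ≤
      (q.atoms.map fun α => 1 + α.args.length).sum :=
    List.sum_le_sum fun α _ => Nat.le_add_left _ _
  unfold CQ.size
  omega

section Size

variable {gens : List (Atom Unit)} {C : Atom Unit → Pointed} {q : CQ} {s : ℕ}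

theorem length_bodies_le (hs : gens.length + q.size ≤ s) (g : Gate) :
    (bodies gens C q g).length ≤ s + 4 := by
  classical
  have hf : ∀ p : Atom Unit → Prop, (gens.filter fun g => p g).length ≤ s := fun p =>
    (List.length_filter_le _ _).trans (by omega)
  rcases g with _ | _ | α | ⟨_ | k, l, l'⟩
  · simp [bodies]
  · simp [bodies]
  · have := hf fun g => CompMatch q (C g) α.fst
    simp only [bodies, List.length_cons, List.length_map]
    omega
  · simp only [bodies]
    rcases l with _ | ⟨z, _ | _⟩ <;> rcases l' with _ | ⟨z', _ | _⟩ <;>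
      simp only [okBodies, List.length_singleton] <;> try omega
    have := hf fun g => LocalMatch q (C g) z
    split_ifs <;> simp only [List.length_map, List.length_nil, List.length_singleton] <;> omega
  · simp [bodies]

theorem length_body_le (hs : gens.length + q.size ≤ s) {g : Gate} {b : List DAtom}
    (hb : b ∈ bodies gens C q g) : b.length ≤ s + 5 := by
  classical
  have h1 := q.length_atoms_le
  have h2 := q.length_vars_le
  rcases g with _ | _ | α | ⟨_ | k, l, l'⟩
  · simp [bodies] at hb
  · simp [bodies] at hb
  · simp only [bodies, List.mem_cons, List.mem_map] at hb
    rcases hb with rfl | ⟨-, -, rfl⟩ <;> simp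
  · simp only [bodies] at hb
    rcases l with _ | ⟨z, _ | _⟩ <;> rcases l' with _ | ⟨z', _ | _⟩ <;>
      simp only [okBodies, List.mem_singleton] at hb <;> try (subst hb; simp)
    · split_ifs at hb
      · obtain ⟨-, -, rfl⟩ := List.mem_map.1 hb
        have := List.length_filter_le (fun z' => decide (q.Cooccur z z')) q.vars
        simp only [List.length_cons, List.length_map]
        omega
      · simp at hb
      · simp at hb
      · simp only [List.mem_singleton] at hb
        simp [hb]
    · exact (List.length_filter_le _ _).trans (by omega)
  · simp only [bodies, List.mem_cons, List.not_mem_nil, or_false] at hb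
    rcases hb with rfl | rfl | rfl | rfl <;> simp

/-- One gate per atom, and at each elimination stage one per pair of literals. -/
theorem length_gates_le (hs : gens.length + q.size ≤ s) :
    (gates q).length ≤ s + (s + 1) * ((2 * s + 1) * (2 * s + 1)) := by
  have h1 := q.length_atoms_le
  have h2 := q.length_vars_le
  have h3 := length_lits q.vars
  rw [gates, List.length_append, List.length_map]
  refine Nat.add_le_add (by omega) (length_flatMap_le (by rw [List.length_range]; omega) ?_)
  intro k _
  refine length_flatMap_le (by omega) ?_
  intro l _
  rw [List.length_map]
  omega

theorem length_clauses_le (hs : gens.length + q.size ≤ s) : (clauses gens C q).length ≤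
    s * 2 + 1 + (s + (s + 1) * ((2 * s + 1) * (2 * s + 1))) * (s + 4) := by
  have h1 := q.length_atoms_le
  have h2 : (eqClauses gens q).length ≤ s * 2 := by
    refine length_flatMap_le ?_ fun α _ => ?_
    · rw [List.length_append, List.length_map]
      omega
    · rw [List.length_map, List.length_attach]
      exact α.length_args_le
  have h3 : (gateClauses gens C q).length ≤
      (s + (s + 1) * ((2 * s + 1) * (2 * s + 1))) * (s + 4) := by
    refine length_flatMap_le (length_gates_le hs) fun g _ => ?_
    rw [List.length_map]
    exact length_bodies_le hs g
  rw [clauses, List.length_append, List.length_cons]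
  omega

/-- A body has at most `s + 5` atoms proper to its gate and `s` domain atoms, each with at most `s +
2` arguments besides its predicate. -/
theorem clause_size_le (hs : gens.length + q.size ≤ s) {r : Clause}
    (hr : r ∈ clauses gens C q) :
    (1 + r.headArgs.length) + (r.body.map fun β => 1 + β.args.length).sum ≤
      (s + 3) + (2 * s + 5) * (s + 3) := by
  have h2 := q.length_vars_le
  have h3 : q.arity ≤ q.size := by
    unfold CQ.size
    omega
  have hdom : (domAtoms q).length ≤ s := by
    rw [domAtoms, List.length_map]
    omega
  have hdom' : ∀ β ∈ domAtoms q, 1 + β.args.length ≤ s + 3 := by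
    intro β hβ
    obtain ⟨x, -, rfl⟩ := List.mem_map.1 hβ
    simp only [eqAtom, DAtom.args, List.length_cons, List.length_nil]
    omega
  simp only [clauses, List.mem_append, List.mem_cons] at hr
  rcases hr with hr | rfl | hr
  · obtain ⟨α, -, x, -, -, h5, h6⟩ := mem_eqClauses hr
    rw [h5, h6]
    refine Nat.add_le_add (by simp) (sum_map_le (by simp) fun β hβ => ?_)
    have := α.length_args_le
    rw [List.mem_singleton.1 hβ]
    simp only [DAtom.args]
    omega
  · refine Nat.add_le_add ?_ (sum_map_le ?_ fun β hβ => ?_)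
    · simp only [goalClause, List.length_ofFn]
      omega
    · simp only [goalClause, List.length_cons]
      omega
    · rcases List.mem_cons.1 hβ with rfl | hβ
      · simp only [Gate.atom, DAtom.args]
        omega
      · exact hdom' β hβ
  · obtain ⟨g, hg, b, hb, -, h5, h6⟩ := mem_gateClauses hr
    rw [h5, h6]
    refine Nat.add_le_add (by omega) (sum_map_le ?_ fun β hβ => ?_)
    · have := length_body_le hs hb
      rw [List.length_append]
      omega
    · rcases List.mem_append.1 hβ with hβ | hβ
      · have := (bodies_spec hg hb hβ).2.1
        omega
      · exact hdom' β hβ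

theorem size_rewriting_le (hs : gens.length + q.size ≤ s) : (rewriting gens C q).size ≤
    (s * 2 + 1 + (s + (s + 1) * ((2 * s + 1) * (2 * s + 1))) * (s + 4)) *
      ((s + 3) + (2 * s + 5) * (s + 3)) :=
  sum_map_le (length_clauses_le hs) fun _ hr => clause_size_le hs hr

end Size

end OBDA

/-! ### The polynomial bound -/

theorem mainTheorem3 :
    ∃ p : Polynomial ℕ, ∀ (T : OBDA.Ontology) (q : OBDA.CQ), T.DepthLE 1 →
      ∃ (Pr : OBDA.Program) (G : ℕ),
        OBDA.IsNDLRewriting T q Pr G ∧ Pr.size ≤ p.eval (T.size + q.size) := by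
  open Polynomial in
  -- The bound on the number of clauses times the bound on the size of a clause.
  refine ⟨(X * 2 + 1 + (X + (X + 1) * ((2 * X + 1) * (2 * X + 1))) * (X + 4)) *
    ((X + 3) + (2 * X + 5) * (X + 3)), fun T q hT => ?_⟩
  obtain ⟨C, hC⟩ := hT.exists_gen
  refine ⟨_, _, OBDA.isNDLRewriting_rewriting hC q, ?_⟩
  simpa using OBDA.size_rewriting_le (C := C) (q := q) (gens := T.gens) (s := T.size + q.size)
    (by rw [T.length_gens])
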